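/- A \emph{non-ambiguous tree} (NAT) is a filling of an $m\times n$ rectangular grid (rows numbered from top to bottom, columns from left to right), in which each cell is either dotted or not, such that (1) every row and every column contains at least one dotted cell; (2) every dotted cell other than the top-left cell has either a dotted cell above it in the same column, or a dotted cell to its left in the same row, but not both. A NAT is \emph{complete} (a CNAT) if every dot has either both a dot below it in the same column and a dot to its right in the same row, or neither of these. A \emph{leaf dot} is a dot that has no dot below it in its column and no dot to its right in its row. In a CNAT every row and every column contains exactly one leaf dot, so the grid is a square $n\times n$ grid. The \emph{associated permutation} of the CNAT is the permutation $\pi$ of $\{1,\dots,n\}$ for which the leaf dots are exactly the cells in column $j$ and row $\pi_j$, $1\le j\le n$. Let $\mathrm{cnat}(\pi)$ be the number of CNATs whose associated permutation is $\pi$, and let $$b(n,k) := \bigl|\{\pi\in S_n : \mathrm{cnat}(\pi)=k\}\bigr| .$$ \textbf{Theorem.} For every $n\ge 1$ we have $b(n,5)=0$. That is, there is no permutation (of any length) with exactly $5$ associated CNATs. -/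

import Mathlib

/-- A filling of an `m × n` rectangular grid: the finite set of its dotted cells. The cell `(i, j)`
lies in row `i` (rows are numbered from top to bottom) and column `j` (from left to right);
the top-left cell is `(0, 0)`. -/
abbrev Filling (m n : ℕ) : Type := Finset (Fin m × Fin n)

namespace Filling

variable {m n : ℕ}

/-- There is a dotted cell above `(i, j)` in column `j`. -/
def HasAbove (T : Filling m n) (i : Fin m) (j : Fin n) : Prop := ∃ i' : Fin m, i' < i ∧ (i', j) ∈ T

/-- There is a dotted cell to the left of `(i, j)` in row `i`. -/
def HasLeft (T : Filling m n) (i : Fin m) (j : Fin n) : Prop := ∃ j' : Fin n, j' < j ∧ (i, j') ∈ T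

/-- There is a dotted cell below `(i, j)` in column `j`. -/
def HasBelow (T : Filling m n) (i : Fin m) (j : Fin n) : Prop := ∃ i' : Fin m, i < i' ∧ (i', j) ∈ T

/-- There is a dotted cell to the right of `(i, j)` in row `i`. -/
def HasRight (T : Filling m n) (i : Fin m) (j : Fin n) : Prop := ∃ j' : Fin n, j < j' ∧ (i, j') ∈ T

/-- Non-ambiguous trees (NATs). -/
structure IsNAT (T : Filling m n) : Prop where
  row_nonempty : ∀ i : Fin m, ∃ j : Fin n, (i, j) ∈ T
  col_nonempty : ∀ j : Fin n, ∃ i : Fin m, (i, j) ∈ T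
  unique_parent : ∀ (i : Fin m) (j : Fin n), (i, j) ∈ T → ¬ ((i : ℕ) = 0 ∧ (j : ℕ) = 0) →
    Xor (T.HasAbove i j) (T.HasLeft i j)

/-- Complete non-ambiguous trees (CNATs): every dot has both a dot below it in its column and a dot
to its right in its row, or neither. -/
structure IsCNAT (T : Filling m n) : Prop extends IsNAT T where
  complete : ∀ (i : Fin m) (j : Fin n), (i, j) ∈ T → (T.HasBelow i j ↔ T.HasRight i j)

/-- The cell `(i, j)` holds a leaf dot. -/
def IsLeaf (T : Filling m n) (i : Fin m) (j : Fin n) : Prop :=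
  (i, j) ∈ T ∧ ¬ T.HasBelow i j ∧ ¬ T.HasRight i j

/-- The leaf dots of `T` form the graphical representation of the permutation `π`, which has a dot
in column `j` and row `π j` for every `j`. -/
def HasPerm (T : Filling n n) (π : Equiv.Perm (Fin n)) : Prop :=
  ∀ i j : Fin n, T.IsLeaf i j ↔ i = π j

end Filling

/-- The set of CNATs whose associated permutation is `π`. -/
def cnatSet {n : ℕ} (π : Equiv.Perm (Fin n)) : Set (Filling n n) :=
  {T | T.IsCNAT ∧ T.HasPerm π}

/-- The number of CNATs whose associated permutation is `π`. -/
noncomputable def cnat {n : ℕ} (π : Equiv.Perm (Fin n)) : ℕ := (cnatSet π).ncard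

/-- The set `B(n, k)` of permutations of length `n` with exactly `k` associated CNATs. -/
def permsWithCNATs (n k : ℕ) : Set (Equiv.Perm (Fin n)) := {π | cnat π = k}

/-- The number `b(n, k)` of permutations of length `n` with exactly `k` associated CNATs. -/
noncomputable def numPermsWithCNATs (n k : ℕ) : ℕ := (permsWithCNATs n k).ncard

/-! Label rows and columns by leaf dots, and for a set `W` of leaves let `f W` count the CNATs on
its rows and columns. Let `a`, `b` be the leaves in the first column and the first row. If `a ≠ b`,
removing the root `(b, a)` leaves two CNATs, one whose leaf set contains `a` and one whose leaf set
contains `b`; any such pair glues back, so `f W = ∑ f A * f (W \ A)` over all `A` containing `a` but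
not `b`. Here `a`, `b` form an edge of the inversion graph. Splitting a second time gives sums over
partitions into three parts that are symmetric in the two pairs used (`splitSum_exchange`). Hence
the recurrence holds along every edge, and `f` depends only on the graph (`IsSplitCount`).

The graph then controls growth. A new vertex with `d` neighbours multiplies `f` by at least `d`
(`mul_le_insert`), and by exactly `d` if these form a clique (`insert_of_clique`). Disconnected sets
have `f = 0`. A connected graph is built vertex by vertex from a small induced subgraph: an induced
4-cycle has value 3, after which only 3 or values at least 6 occur; without induced 4-cycles, a
triangle has value 2, after which only 2, 4 or values at least 6 occur; with neither, the value
stays 1. The last two cases use that in an inversion graph, a vertex with several pairwise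
nonadjacent neighbours in a connected set lies on an induced 4-cycle (`hasSquare_of_independent`).
-/

/-- The sum of `f A * f (W \ A)` over the subsets `A` of `W` that contain `a` but not `b`. -/
def splitSum {V : Type*} [DecidableEq V] (f : Finset V → ℕ) (W : Finset V) (a b : V) : ℕ :=
  ∑ A ∈ W.powerset, if a ∈ A ∧ b ∉ A then f A * f (W \ A) else 0

/-- A function on vertex sets that takes the value `1` on single vertices, vanishes on larger
edgeless sets, and can be computed by splitting a vertex set along any of its edges. -/
structure IsSplitCount {V : Type*} [DecidableEq V] (G : SimpleGraph V) (f : Finset V → ℕ) :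
    Prop where
  singleton : ∀ v, f {v} = 1
  edgeless : ∀ W : Finset V, W.Nontrivial → (∀ a ∈ W, ∀ b ∈ W, ¬ G.Adj a b) → f W = 0
  split : ∀ (W : Finset V) (a b : V), a ∈ W → b ∈ W → G.Adj a b → f W = splitSum f W a b

/-! ### Independence of the splitting pair -/

section TripleSums

variable {V : Type*} [DecidableEq V]

/-- Sum over the ordered partitions of `W` into three parts. -/
def tripleSum (W : Finset V) (F : Finset V → Finset V → Finset V → ℕ) : ℕ :=
  ∑ A ∈ W.powerset, ∑ C ∈ (W \ A).powerset, F A C ((W \ A) \ C)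

theorem sum_powerset_compl (W : Finset V) (F : Finset V → Finset V → ℕ) :
    ∑ A ∈ W.powerset, F A (W \ A) = ∑ A ∈ W.powerset, F (W \ A) A := by
  refine Finset.sum_bij' (fun A _ => W \ A) (fun A _ => W \ A) ?_ ?_ ?_ ?_ ?_
  · intro A _; simp
  · intro A _; simp
  · intro A hA; simpa using hA
  · intro A hA; simpa using hA
  · intro A hA
    have : W \ (W \ A) = A := by simpa using hA
    simp [this]

theorem sum_sum_powerset_eq_tripleSum (W : Finset V)
    (F : Finset V → Finset V → Finset V → ℕ) :
    ∑ A ∈ W.powerset, ∑ C ∈ A.powerset, F C (A \ C) (W \ A) = tripleSum W F := by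
  unfold tripleSum
  rw [Finset.sum_sigma', Finset.sum_sigma']
  refine Finset.sum_bij' (fun x _ => ⟨x.2, x.1 \ x.2⟩) (fun x _ => ⟨x.1 ∪ x.2, x.1⟩) ?_ ?_ ?_ ?_ ?_
  · rintro ⟨A, C⟩ h
    simp only [Finset.mem_sigma, Finset.mem_powerset] at h ⊢
    exact ⟨h.2.trans h.1, Finset.sdiff_subset_sdiff h.1 le_rfl⟩
  · rintro ⟨A, C⟩ h
    simp only [Finset.mem_sigma, Finset.mem_powerset] at h ⊢
    exact ⟨Finset.union_subset h.1 (h.2.trans Finset.sdiff_subset), Finset.subset_union_left⟩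
  · rintro ⟨A, C⟩ h
    simp only [Finset.mem_sigma, Finset.mem_powerset] at h ⊢
    simp [Finset.union_sdiff_of_subset h.2]
  · rintro ⟨A, C⟩ h
    simp only [Finset.mem_sigma, Finset.mem_powerset, Finset.subset_sdiff] at h ⊢
    have : (A ∪ C) \ A = C := by
      rw [Finset.union_sdiff_cancel_left h.2.2.symm]
    simp [this]
  · rintro ⟨A, C⟩ h
    simp only [Finset.mem_sigma, Finset.mem_powerset] at h ⊢
    have : W \ A = (W \ C) \ (A \ C) := by
      rw [sdiff_sdiff_left, Finset.sup_eq_union, Finset.union_sdiff_of_subset h.2]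
    rw [this]

theorem tripleSum_swap_right (W : Finset V) (F : Finset V → Finset V → Finset V → ℕ) :
    tripleSum W F = tripleSum W (fun X Y Z => F X Z Y) :=
  Finset.sum_congr rfl fun A _ => sum_powerset_compl (W \ A) (F A)

theorem tripleSum_swap_left (W : Finset V) (F : Finset V → Finset V → Finset V → ℕ) :
    tripleSum W F = tripleSum W (fun X Y Z => F Y X Z) := by
  rw [← sum_sum_powerset_eq_tripleSum, ← sum_sum_powerset_eq_tripleSum]
  exact Finset.sum_congr rfl fun A _ => sum_powerset_compl A (fun X Y => F X Y (W \ A))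

/-- The product of `f` over three parts, restricted to those partitions for which the given
vertices lie in the first, second, third part. -/
def tripleTerm (f : Finset V → ℕ) (a a' b b' c c' : V) (X Y Z : Finset V) : ℕ :=
  if a ∈ X ∧ a' ∈ X ∧ b ∈ Y ∧ b' ∈ Y ∧ c ∈ Z ∧ c' ∈ Z then f X * f Y * f Z else 0

theorem tripleSum_term_swap_right (f : Finset V → ℕ) (W : Finset V) (a a' b b' c c' : V) :
    tripleSum W (tripleTerm f a a' b b' c c') = tripleSum W (tripleTerm f a a' c c' b b') := by
  rw [tripleSum_swap_right]
  congr 1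
  funext X Y Z
  simp only [tripleTerm]
  congr 1
  · simp only [eq_iff_iff]; tauto
  · ring

theorem tripleSum_term_swap_left (f : Finset V → ℕ) (W : Finset V) (a a' b b' c c' : V) :
    tripleSum W (tripleTerm f a a' b b' c c') = tripleSum W (tripleTerm f b b' a a' c c') := by
  rw [tripleSum_swap_left]
  congr 1
  funext X Y Z
  simp only [tripleTerm]
  congr 1
  · simp only [eq_iff_iff]; tauto
  · ring

/-- If `f` can be split along the pair `c`, `d` on all proper subsets, then splitting along a pair
`a`, `b` can be refined. -/
theorem splitSum_refine (f : Finset V → ℕ) {W : Finset V} {a b c d : V}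
    (ha : a ∈ W) (hb : b ∈ W) (hc : c ∈ W) (hd : d ∈ W)
    (h : ∀ X, X ⊂ W → c ∈ X → d ∈ X → f X = splitSum f X c d) :
    splitSum f W a b =
      (∑ A ∈ W.powerset, if a ∈ A ∧ c ∈ A ∧ b ∉ A ∧ d ∉ A then f A * f (W \ A) else 0) +
      (∑ A ∈ W.powerset, if a ∈ A ∧ d ∈ A ∧ b ∉ A ∧ c ∉ A then f A * f (W \ A) else 0) +
      (tripleSum W (tripleTerm f a c d d b b) + tripleSum W (tripleTerm f c c a d b b)) +
      (tripleSum W (tripleTerm f a a b c d d) + tripleSum W (tripleTerm f a a c c b d)) := by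
  -- Both `c` and `d` lie on the side of `a`: split that side again; `a` goes either with `c` or
  -- with `d`.
  have h3 : tripleSum W (tripleTerm f a c d d b b) + tripleSum W (tripleTerm f c c a d b b) =
      ∑ A ∈ W.powerset, if a ∈ A ∧ b ∉ A ∧ c ∈ A ∧ d ∈ A then f A * f (W \ A) else 0 := by
    rw [← sum_sum_powerset_eq_tripleSum, ← sum_sum_powerset_eq_tripleSum,
      ← Finset.sum_add_distrib]
    refine Finset.sum_congr rfl fun A hA => ?_
    rw [Finset.mem_powerset] at hA
    rw [← Finset.sum_add_distrib]
    split_ifs with hA'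
    · obtain ⟨h1, h2, h3, h4⟩ := hA'
      rw [h A (Finset.ssubset_iff_subset_ne.2 ⟨hA, fun e => h2 (e ▸ hb)⟩) h3 h4, splitSum,
        Finset.sum_mul]
      refine Finset.sum_congr rfl fun C hC => ?_
      simp only [tripleTerm, Finset.mem_sdiff]
      by_cases haC : a ∈ C <;> simp [haC, h1, h2, h4, hb, ite_mul]
    · refine Finset.sum_eq_zero fun C hC => ?_
      rw [Finset.mem_powerset] at hC
      simp only [tripleTerm, Finset.mem_sdiff]
      rw [if_neg, if_neg]
      · rfl
      · rintro ⟨h1, h2, ⟨h3, _⟩, ⟨h4, _⟩, ⟨_, h5⟩, _⟩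
        exact hA' ⟨h3, h5, hC h1, h4⟩
      · rintro ⟨h1, h2, ⟨h3, _⟩, ⟨h4, _⟩, ⟨_, h5⟩, _⟩
        exact hA' ⟨hC h1, h5, hC h2, h3⟩
  -- Both `c` and `d` lie on the side of `b`, which is split again.
  have h4 : tripleSum W (tripleTerm f a a b c d d) + tripleSum W (tripleTerm f a a c c b d) =
      ∑ A ∈ W.powerset, if a ∈ A ∧ b ∉ A ∧ c ∉ A ∧ d ∉ A then f A * f (W \ A) else 0 := by
    unfold tripleSum
    rw [← Finset.sum_add_distrib]
    refine Finset.sum_congr rfl fun A hA => ?_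
    rw [Finset.mem_powerset] at hA
    rw [← Finset.sum_add_distrib]
    split_ifs with hA'
    · obtain ⟨h1, h2, h3, h4⟩ := hA'
      rw [h (W \ A) (Finset.ssubset_iff_subset_ne.2 ⟨Finset.sdiff_subset,
          fun e => (Finset.mem_sdiff.1 (e.symm ▸ ha)).2 h1⟩)
          (Finset.mem_sdiff.2 ⟨hc, h3⟩) (Finset.mem_sdiff.2 ⟨hd, h4⟩), splitSum,
        Finset.mul_sum]
      refine Finset.sum_congr rfl fun C hC => ?_
      simp only [tripleTerm, Finset.mem_sdiff]
      by_cases hbC : b ∈ C <;> simp [hbC, h1, h2, h4, hb, hd, mul_ite, mul_assoc]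
    · refine Finset.sum_eq_zero fun C hC => ?_
      rw [Finset.mem_powerset] at hC
      have hC' : ∀ x ∈ C, x ∉ A := fun x hx => (Finset.mem_sdiff.1 (hC hx)).2
      simp only [tripleTerm, Finset.mem_sdiff]
      rw [if_neg, if_neg]
      · rfl
      · rintro ⟨h1, h2, h3, h4, ⟨⟨_, h5⟩, _⟩, ⟨⟨_, h6⟩, _⟩⟩
        exact hA' ⟨h1, h5, hC' _ h3, h6⟩
      · rintro ⟨h1, h2, h3, h4, ⟨⟨_, h5⟩, _⟩, ⟨⟨_, h6⟩, _⟩⟩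
        exact hA' ⟨h1, hC' _ h3, hC' _ h4, h6⟩
  rw [h3, h4, splitSum, ← Finset.sum_add_distrib, ← Finset.sum_add_distrib,
    ← Finset.sum_add_distrib]
  refine Finset.sum_congr rfl fun A _ => ?_
  by_cases h1 : a ∈ A <;> by_cases h2 : b ∈ A <;> by_cases h3 : c ∈ A <;> by_cases h4 : d ∈ A <;>
    simp [h1, h2, h3, h4]

/-- Splitting along two different pairs gives the same result, if splitting along either of them
is possible on all proper subsets. -/
theorem splitSum_exchange (f : Finset V → ℕ) {W : Finset V} {a b c d : V}
    (ha : a ∈ W) (hb : b ∈ W) (hc : c ∈ W) (hd : d ∈ W)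
    (h : ∀ X, X ⊂ W → c ∈ X → d ∈ X → f X = splitSum f X c d)
    (h' : ∀ X, X ⊂ W → a ∈ X → b ∈ X → f X = splitSum f X a b) :
    splitSum f W a b = splitSum f W c d := by
  -- The two refinements contain the same terms, up to complementing `A` and permuting the three
  -- parts.
  rw [splitSum_refine f ha hb hc hd h, splitSum_refine f hc hd ha hb h']
  have e1 : (∑ A ∈ W.powerset, if a ∈ A ∧ c ∈ A ∧ b ∉ A ∧ d ∉ A then f A * f (W \ A) else 0) =
      ∑ A ∈ W.powerset, if c ∈ A ∧ a ∈ A ∧ d ∉ A ∧ b ∉ A then f A * f (W \ A) else 0 :=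
    Finset.sum_congr rfl fun A _ => by congr 1; simp only [eq_iff_iff]; tauto
  have e2 : (∑ A ∈ W.powerset, if a ∈ A ∧ d ∈ A ∧ b ∉ A ∧ c ∉ A then f A * f (W \ A) else 0) =
      ∑ A ∈ W.powerset, if c ∈ A ∧ b ∈ A ∧ d ∉ A ∧ a ∉ A then f A * f (W \ A) else 0 := by
    have h := sum_powerset_compl W
      (fun A B => if a ∈ A ∧ d ∈ A ∧ b ∈ B ∧ c ∈ B then f A * f B else 0)
    have e1 : ∀ A, (if a ∈ A ∧ d ∈ A ∧ b ∈ W \ A ∧ c ∈ W \ A then f A * f (W \ A) else 0) =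
        (if a ∈ A ∧ d ∈ A ∧ b ∉ A ∧ c ∉ A then f A * f (W \ A) else 0) := by
      intro A; simp [hb, hc]
    have e2 : ∀ A, (if a ∈ W \ A ∧ d ∈ W \ A ∧ b ∈ A ∧ c ∈ A then f (W \ A) * f A else 0) =
        (if c ∈ A ∧ b ∈ A ∧ d ∉ A ∧ a ∉ A then f A * f (W \ A) else 0) := by
      intro A
      congr 1
      · simp only [eq_iff_iff, Finset.mem_sdiff]; tauto
      · ring
    simpa only [e1, e2] using h
  have t1 : tripleSum W (tripleTerm f a c d d b b) = tripleSum W (tripleTerm f c a b b d d) := by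
    rw [tripleSum_term_swap_right]
    congr 1; funext X Y Z; simp only [tripleTerm]; congr 1; simp only [eq_iff_iff]; tauto
  have t2 : tripleSum W (tripleTerm f c c a d b b) = tripleSum W (tripleTerm f c c d a b b) := by
    congr 1; funext X Y Z; simp only [tripleTerm]; congr 1; simp only [eq_iff_iff]; tauto
  have t3 : tripleSum W (tripleTerm f a a b c d d) = tripleSum W (tripleTerm f a a c b d d) := by
    congr 1; funext X Y Z; simp only [tripleTerm]; congr 1; simp only [eq_iff_iff]; tauto
  have t4 : tripleSum W (tripleTerm f a a c c b d) = tripleSum W (tripleTerm f c c a a d b) := by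
    rw [tripleSum_term_swap_left]
    congr 1; funext X Y Z; simp only [tripleTerm]; congr 1; simp only [eq_iff_iff]; tauto
  rw [e1, e2, t1, t2, t3, t4]
  ring

end TripleSums

/-! ### Counts determined by splitting along edges -/

section SplitCounts

variable {V : Type*} {G : SimpleGraph V} {f : Finset V → ℕ}

open Classical in
/-- The neighbours of `v` in `W`. -/
noncomputable def nbrs (G : SimpleGraph V) (v : V) (W : Finset V) : Finset V :=
  W.filter (G.Adj v)

theorem mem_nbrs {v u : V} {W : Finset V} : u ∈ nbrs G v W ↔ u ∈ W ∧ G.Adj v u := by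
  simp [nbrs]

theorem exists_isolated_of_edgeless {v : V} {W : Finset V}
    (hW : W.Nontrivial) (he : ∀ a ∈ W, ∀ b ∈ W, ¬ G.Adj a b)
    (hN : ∀ x ∈ nbrs G v W, ∀ y ∈ nbrs G v W, x ≠ y → G.Adj x y) :
    ∃ w ∈ W, ¬ G.Adj v w := by
  by_contra! h
  obtain ⟨x, hx, y, hy, hxy⟩ := hW
  exact he x hx y hy (hN x (mem_nbrs.2 ⟨hx, h x hx⟩) y (mem_nbrs.2 ⟨hy, h y hy⟩) hxy)

variable [DecidableEq V]

theorem card_nbrs_add_card_nbrs_sdiff (v : V) {A W : Finset V} (h : A ⊆ W) :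
    (nbrs G v A).card + (nbrs G v (W \ A)).card = (nbrs G v W).card := by
  have hd : Disjoint (nbrs G v A) (nbrs G v (W \ A)) := by
    rw [Finset.disjoint_left]
    intro x hx hx'
    exact (Finset.mem_sdiff.1 (mem_nbrs.1 hx').1).2 (mem_nbrs.1 hx).1
  rw [← Finset.card_union_of_disjoint hd]
  congr 1
  ext x
  simp only [Finset.mem_union, mem_nbrs, Finset.mem_sdiff]
  constructor
  · rintro (⟨h1, h2⟩ | ⟨⟨h1, _⟩, h2⟩)
    · exact ⟨h h1, h2⟩
    · exact ⟨h1, h2⟩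
  · rintro ⟨h1, h2⟩
    by_cases hx : x ∈ A
    · exact Or.inl ⟨hx, h2⟩
    · exact Or.inr ⟨⟨h1, hx⟩, h2⟩

namespace IsSplitCount

/-- A vertex set without edges between two nonempty complementary parts has count zero. -/
theorem eq_zero_of_separated (hf : IsSplitCount G f) (S : Set V) (W : Finset V)
    (hs : ∃ s ∈ W, s ∈ S) (ht : ∃ t ∈ W, t ∉ S)
    (h : ∀ s ∈ W, s ∈ S → ∀ t ∈ W, t ∉ S → ¬ G.Adj s t) : f W = 0 := by
  induction W using Finset.strongInduction with
  | H W ih =>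
    obtain ⟨s, hsW, hsS⟩ := hs
    obtain ⟨t, htW, htS⟩ := ht
    by_cases he : ∃ a ∈ W, ∃ b ∈ W, G.Adj a b
    · obtain ⟨a, ha, b, hb, hab⟩ := he
      rw [hf.split W a b ha hb hab, splitSum]
      refine Finset.sum_eq_zero fun A hA => ?_
      rw [Finset.mem_powerset] at hA
      split_ifs with hA'
      · have h1 : A ⊂ W := Finset.ssubset_iff_subset_ne.2 ⟨hA, fun e => hA'.2 (e ▸ hb)⟩
        have h2 : W \ A ⊂ W := Finset.ssubset_iff_subset_ne.2 ⟨Finset.sdiff_subset,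
          fun e => (Finset.mem_sdiff.1 (e.symm ▸ ha)).2 hA'.1⟩
        have hb' : b ∈ W \ A := Finset.mem_sdiff.2 ⟨hb, hA'.2⟩
        have ih1 := fun x y => ih A h1 x y (fun s hs hs' t ht => h s (hA hs) hs' t (hA ht))
        have ih2 := fun x y => ih (W \ A) h2 x y (fun s hs hs' t ht =>
          h s (Finset.sdiff_subset hs) hs' t (Finset.sdiff_subset ht))
        -- The edge `a`, `b` lies on one side of `S`, and each part contains one of its ends.
        -- Whichever part receives a vertex of the other side is separated too, so its factor
        -- vanishes.
        by_cases haS : a ∈ S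
        · have hbS : b ∈ S := by
            by_contra hbS
            exact h a ha haS b hb hbS hab
          by_cases htA : t ∈ A
          · rw [ih1 ⟨a, hA'.1, haS⟩ ⟨t, htA, htS⟩, zero_mul]
          · rw [ih2 ⟨b, hb', hbS⟩ ⟨t, Finset.mem_sdiff.2 ⟨htW, htA⟩, htS⟩, mul_zero]
        · have hbS : b ∉ S := fun hbS => h b hb hbS a ha haS hab.symm
          by_cases hsA : s ∈ A
          · rw [ih1 ⟨s, hsA, hsS⟩ ⟨a, hA'.1, haS⟩, zero_mul]
          · rw [ih2 ⟨s, Finset.mem_sdiff.2 ⟨hsW, hsA⟩, hsS⟩ ⟨b, hb', hbS⟩, mul_zero]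
      · rfl
    · push Not at he
      exact hf.edgeless W ⟨s, hsW, t, htW, fun e => htS (e ▸ hsS)⟩ he

theorem insert_eq_zero (hf : IsSplitCount G f) {v : V} {W : Finset V} (hW : W.Nonempty)
    (hv : v ∉ W) (h : nbrs G v W = ∅) : f (insert v W) = 0 := by
  obtain ⟨w, hw⟩ := hW
  refine hf.eq_zero_of_separated {v} _ ⟨v, by simp, rfl⟩
    ⟨w, by simp [hw], fun e => hv (Set.mem_singleton_iff.1 e ▸ hw)⟩ ?_
  rintro s - rfl t ht htv hst
  have : t ∈ nbrs G s W :=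
    mem_nbrs.2 ⟨(Finset.mem_insert.1 ht).resolve_left (by simpa using htv), hst⟩
  simp [h] at this

theorem pair (hf : IsSplitCount G f) {a b : V} (h : G.Adj a b) : f {a, b} = 1 := by
  have hab : a ≠ b := h.ne
  rw [hf.split {a, b} a b (by simp) (by simp) h, splitSum,
    Finset.sum_powerset_insert (by simpa using hab)]
  have e : ({b} : Finset V).powerset = {∅, {b}} := by
    ext x; simp [Finset.subset_singleton_iff]
  have e1 : ({a, b} : Finset V) \ {a} = {b} := by
    ext x; simp only [Finset.mem_sdiff, Finset.mem_insert, Finset.mem_singleton]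
    constructor
    · tauto
    · rintro rfl; exact ⟨Or.inr rfl, hab.symm⟩
  rw [e, Finset.sum_pair (by simp), Finset.sum_pair (by simp)]
  simp [hab, hab.symm, hf.singleton, e1]

/-- Splitting `W ∪ {v}` along an edge of `W`. -/
theorem split_insert (hf : IsSplitCount G f) {v a b : V} {W : Finset V} (hv : v ∉ W)
    (ha : a ∈ W) (hb : b ∈ W) (hab : G.Adj a b) :
    f (insert v W) = ∑ A ∈ W.powerset, if a ∈ A ∧ b ∉ A then
      f (insert v A) * f (W \ A) + f A * f (insert v (W \ A)) else 0 := by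
  rw [hf.split _ a b (Finset.mem_insert_of_mem ha) (Finset.mem_insert_of_mem hb) hab, splitSum,
    Finset.sum_powerset_insert hv, ← Finset.sum_add_distrib]
  refine Finset.sum_congr rfl fun A hA => ?_
  rw [Finset.mem_powerset] at hA
  have hvA : v ∉ A := fun h => hv (hA h)
  have hav : a ≠ v := fun e => hv (e ▸ ha)
  have hbv : b ≠ v := fun e => hv (e ▸ hb)
  have e1 : insert v W \ A = insert v (W \ A) := Finset.insert_sdiff_of_notMem _ hvA
  have e2 : insert v W \ insert v A = W \ A := by
    ext x
    simp only [Finset.mem_sdiff, Finset.mem_insert]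
    constructor
    · tauto
    · rintro ⟨h1, h2⟩
      exact ⟨Or.inr h1, fun h => h.elim (fun e => hv (e ▸ h1)) h2⟩
  simp only [Finset.mem_insert, hav, hbv, false_or, e1, e2]
  split_ifs <;> ring

/-- Splitting along an edge of `W` puts `v` into either part, and the numbers of neighbours of `v`
in the two parts add up to the number in `W`. So the bound passes from the parts to `W`. -/
theorem mul_le_insert (hf : IsSplitCount G f) {v : V} {W : Finset V} (hW : W.Nonempty)
    (hv : v ∉ W) : (nbrs G v W).card * f W ≤ f (insert v W) := by
  induction W using Finset.strongInduction with
  | H W ih =>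
    by_cases he : ∃ a ∈ W, ∃ b ∈ W, G.Adj a b
    · obtain ⟨a, ha, b, hb, hab⟩ := he
      rw [hf.split_insert hv ha hb hab, hf.split W a b ha hb hab, splitSum, Finset.mul_sum]
      refine Finset.sum_le_sum fun A hA => ?_
      rw [Finset.mem_powerset] at hA
      split_ifs with hA'
      · have h1 : A ⊂ W := Finset.ssubset_iff_subset_ne.2 ⟨hA, fun e => hA'.2 (e ▸ hb)⟩
        have h2 : W \ A ⊂ W := Finset.ssubset_iff_subset_ne.2 ⟨Finset.sdiff_subset,
          fun e => (Finset.mem_sdiff.1 (e.symm ▸ ha)).2 hA'.1⟩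
        have ih1 := ih A h1 ⟨a, hA'.1⟩ (fun h => hv (hA h))
        have ih2 := ih (W \ A) h2 ⟨b, Finset.mem_sdiff.2 ⟨hb, hA'.2⟩⟩
          (fun h => hv (Finset.sdiff_subset h))
        calc (nbrs G v W).card * (f A * f (W \ A))
            = ((nbrs G v A).card * f A) * f (W \ A) +
              f A * ((nbrs G v (W \ A)).card * f (W \ A)) := by
              rw [← card_nbrs_add_card_nbrs_sdiff v hA]; ring
          _ ≤ _ := by gcongr
      · simp
    · push Not at he
      rcases hW.exists_eq_singleton_or_nontrivial with ⟨w, rfl⟩ | hW'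
      · by_cases h : G.Adj v w
        · rw [hf.pair h, hf.singleton, mul_one]
          exact (Finset.card_le_card fun x hx => (mem_nbrs.1 hx).1).trans (by simp)
        · have : nbrs G v {w} = ∅ := by
            ext x; simp only [mem_nbrs, Finset.mem_singleton, Finset.notMem_empty, iff_false]
            rintro ⟨rfl, h'⟩; exact h h'
          simp [this]
      · rw [hf.edgeless W hW' he]; simp

/-- The recursion of `mul_le_insert` with equalities. The clique condition enters when `W` is
edgeless with several points: then some point of `W` is isolated even after adding `v`, and both
sides vanish. -/
theorem insert_of_clique (hf : IsSplitCount G f) {v : V} {W : Finset V} (hW : W.Nonempty)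
    (hv : v ∉ W) (hN : ∀ x ∈ nbrs G v W, ∀ y ∈ nbrs G v W, x ≠ y → G.Adj x y) :
    f (insert v W) = (nbrs G v W).card * f W := by
  induction W using Finset.strongInduction with
  | H W ih =>
    by_cases he : ∃ a ∈ W, ∃ b ∈ W, G.Adj a b
    · obtain ⟨a, ha, b, hb, hab⟩ := he
      rw [hf.split_insert hv ha hb hab, hf.split W a b ha hb hab, splitSum, Finset.mul_sum]
      refine Finset.sum_congr rfl fun A hA => ?_
      rw [Finset.mem_powerset] at hA
      split_ifs with hA'
      · have h1 : A ⊂ W := Finset.ssubset_iff_subset_ne.2 ⟨hA, fun e => hA'.2 (e ▸ hb)⟩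
        have h2 : W \ A ⊂ W := Finset.ssubset_iff_subset_ne.2 ⟨Finset.sdiff_subset,
          fun e => (Finset.mem_sdiff.1 (e.symm ▸ ha)).2 hA'.1⟩
        have hsub : ∀ {X}, X ⊆ W → ∀ x ∈ nbrs G v X, x ∈ nbrs G v W := fun hX x hx =>
          mem_nbrs.2 ⟨hX (mem_nbrs.1 hx).1, (mem_nbrs.1 hx).2⟩
        rw [ih A h1 ⟨a, hA'.1⟩ (fun h => hv (hA h))
            (fun x hx y hy => hN x (hsub hA x hx) y (hsub hA y hy)),
          ih (W \ A) h2 ⟨b, Finset.mem_sdiff.2 ⟨hb, hA'.2⟩⟩ (fun h => hv (Finset.sdiff_subset h))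
            (fun x hx y hy => hN x (hsub Finset.sdiff_subset x hx) y
              (hsub Finset.sdiff_subset y hy)),
          ← card_nbrs_add_card_nbrs_sdiff v hA]
        ring
      · simp
    · push Not at he
      rcases hW.exists_eq_singleton_or_nontrivial with ⟨w, rfl⟩ | hW'
      · by_cases h : G.Adj v w
        · have : nbrs G v {w} = {w} := by
            ext x; simp only [mem_nbrs, Finset.mem_singleton, and_iff_left_iff_imp]
            rintro rfl; exact h
          rw [hf.pair h, hf.singleton, this]; simp
        · have : nbrs G v {w} = ∅ := by
            ext x; simp only [mem_nbrs, Finset.mem_singleton, Finset.notMem_empty, iff_false]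
            rintro ⟨rfl, h'⟩; exact h h'
          rw [hf.insert_eq_zero (by simp) hv this, this]; simp
      · obtain ⟨w, hw, hvw⟩ := exists_isolated_of_edgeless hW' he hN
        rw [hf.edgeless W hW' he, mul_zero]
        refine hf.eq_zero_of_separated {w} _ ⟨w, by simp [hw], rfl⟩
          ⟨v, by simp, fun e => hv (Set.mem_singleton_iff.1 e ▸ hw)⟩ ?_
        rintro s - rfl t ht - hst
        rcases Finset.mem_insert.1 ht with rfl | ht
        · exact hvw hst.symm
        · exact he s hw t ht hst

theorem path (hf : IsSplitCount G f) {a b c : V} (hab : G.Adj a b) (hbc : G.Adj b c)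
    (hac : ¬ G.Adj a c) (hne : a ≠ c) : f {a, b, c} = 1 := by
  have : nbrs G a {b, c} = {b} := by
    ext x
    simp only [mem_nbrs, Finset.mem_insert, Finset.mem_singleton]
    constructor
    · rintro ⟨rfl | rfl, h⟩
      · rfl
      · exact absurd h hac
    · rintro rfl; exact ⟨Or.inl rfl, hab⟩
  rw [hf.insert_of_clique (by simp) (by simp [hab.ne, hne]), this, hf.pair hbc]
  · simp
  · simp only [this, Finset.mem_singleton]
    rintro x rfl y rfl h
    exact absurd rfl h

theorem triangle (hf : IsSplitCount G f) {a b c : V} (hab : G.Adj a b) (hbc : G.Adj b c)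
    (hac : G.Adj a c) : f {a, b, c} = 2 := by
  have : nbrs G a {b, c} = {b, c} := by
    ext x
    simp only [mem_nbrs, Finset.mem_insert, Finset.mem_singleton, and_iff_left_iff_imp]
    rintro (rfl | rfl) <;> assumption
  rw [hf.insert_of_clique (by simp) (by simp [hab.ne, hac.ne]), this, hf.pair hbc,
    Finset.card_pair hbc.ne]
  simp only [this, Finset.mem_insert, Finset.mem_singleton]
  rintro x (rfl | rfl) y (rfl | rfl) h
  · exact absurd rfl h
  · exact hbc
  · exact hbc.symm
  · exact absurd rfl h

/-- Splitting along `x`, `p`, the part `{x}` of the path `x`, `p`, `y` contributes 2 (with `v` in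
either part), and `{x, y}` contributes 1, since `{x, y}` alone has no edge. -/
theorem square (hf : IsSplitCount G f) {v x p y : V} (hvx : G.Adj v x) (hxp : G.Adj x p)
    (hpy : G.Adj p y) (hyv : G.Adj y v) (hvp : ¬ G.Adj v p) (hxy : ¬ G.Adj x y)
    (hvp' : v ≠ p) (hxy' : x ≠ y) : f {v, x, p, y} = 3 := by
  have hx : x ∉ ({p, y} : Finset V) := by simp [hxp.ne, hxy']
  have hp : p ∉ ({y} : Finset V) := by simp [hpy.ne]
  rw [hf.split_insert (a := x) (b := p) (by simp [hvx.ne, hvp', hyv.ne.symm]) (by simp) (by simp)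
    hxp, Finset.sum_powerset_insert hx, Finset.sum_powerset_insert hp,
    Finset.sum_powerset_insert hp]
  have e : ({y} : Finset V).powerset = {∅, {y}} := by
    ext x; simp [Finset.subset_singleton_iff]
  have e1 : ({x, p, y} : Finset V) \ {x} = {p, y} := by
    ext z; simp only [Finset.mem_sdiff, Finset.mem_insert, Finset.mem_singleton]
    constructor
    · tauto
    · rintro (rfl | rfl)
      · exact ⟨by simp, hxp.ne.symm⟩
      · exact ⟨by simp, hxy'.symm⟩
  have e2 : ({x, p, y} : Finset V) \ {x, y} = {p} := by
    ext z; simp only [Finset.mem_sdiff, Finset.mem_insert, Finset.mem_singleton]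
    constructor
    · tauto
    · rintro rfl; simp [hxp.ne.symm, hpy.ne]
  rw [e]
  simp only [Finset.sum_pair (Finset.singleton_ne_empty y).symm]
  have h0 : f {x, y} = 0 := by
    refine hf.insert_eq_zero (by simp) (by simpa using hxy') ?_
    ext z; simp only [mem_nbrs, Finset.mem_singleton, Finset.notMem_empty, iff_false]
    rintro ⟨rfl, h⟩; exact hxy h
  have h1 : f {v, p, y} = 1 := by
    rw [Finset.pair_comm]; exact hf.path hyv.symm hpy.symm hvp hvp'
  have h2 : f {v, x, y} = 1 := by
    rw [Finset.insert_comm]; exact hf.path hvx.symm hyv.symm hxy hxy'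
  simp [hxp.ne, hxy', hxp.ne.symm, hpy.ne, e1, e2, h0, h1, h2, hf.singleton, hf.pair hvx,
    hf.pair hpy]

end IsSplitCount

end SplitCounts

/-! ### Induced 4-cycles in inversion graphs -/

section InversionGraph

variable {V : Type*} {p q : V → ℕ}

/-- The inversion graph of a point set with coordinates `p` and `q`: two points are adjacent if
they are ordered differently by the two coordinates. -/
def invGraph (p q : V → ℕ) : SimpleGraph V where
  Adj u v := (p u < p v ∧ q v < q u) ∨ (p v < p u ∧ q u < q v)
  symm := ⟨fun _ _ h => h.symm⟩
  loopless := ⟨fun _ h => by omega⟩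

theorem invGraph_adj {u v : V} :
    (invGraph p q).Adj u v ↔ (p u < p v ∧ q v < q u) ∨ (p v < p u ∧ q u < q v) := Iff.rfl

theorem invGraph_swap : invGraph q p = invGraph p q := by
  ext u v; simp only [invGraph_adj]; tauto

/-- Every two complementary nonempty parts of `W` are joined by an edge. -/
def Unseparated (G : SimpleGraph V) (W : Finset V) : Prop :=
  ∀ S : Set V, (∃ s ∈ W, s ∈ S) → (∃ t ∈ W, t ∉ S) → ∃ s ∈ W, s ∈ S ∧ ∃ t ∈ W, t ∉ S ∧ G.Adj s t

/-- All neighbours of `v` lie in one quadrant and form an increasing chain. Cutting `W` between its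
lowest member `x` together with the quadrant `p w < p v`, `q w < q v`, and everything else, an edge
across the cut yields the common neighbour. -/
theorem exists_common_neighbor_of_lt (hp : p.Injective) (hq : q.Injective) {W : Finset V} {v : V}
    (hW : Unseparated (invGraph p q) W) (hv : v ∉ W) (hN : (nbrs (invGraph p q) v W).Nontrivial)
    (hI : ∀ x ∈ nbrs (invGraph p q) v W, ∀ y ∈ nbrs (invGraph p q) v W,
      ¬ (invGraph p q).Adj x y)
    (hlt : ∀ x ∈ nbrs (invGraph p q) v W, p x < p v ∧ q v < q x) :
    ∃ x ∈ nbrs (invGraph p q) v W, ∃ y ∈ nbrs (invGraph p q) v W, x ≠ y ∧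
      ∃ z ∈ W, (invGraph p q).Adj x z ∧ (invGraph p q).Adj z y ∧ ¬ (invGraph p q).Adj v z := by
  set N := nbrs (invGraph p q) v W with hNdef
  obtain ⟨x, hx, hmin⟩ := N.exists_min_image p hN.nonempty
  obtain ⟨y, hy, hyx⟩ := hN.exists_ne x
  have hgt : ∀ z ∈ N, z ≠ x → p x < p z ∧ q x < q z := by
    intro z hz hzx
    have h1 := hmin z hz
    have h2 := hI x hx z hz
    have h3 := hp.ne hzx
    have h4 := hq.ne hzx
    rw [invGraph_adj] at h2
    omega
  obtain ⟨s, hsW, hsS, t, htW, htS, hst⟩ := hW ({x} ∪ {w | p w < p v ∧ q w < q v})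
    ⟨x, (mem_nbrs.1 hx).1, Or.inl rfl⟩ ⟨y, (mem_nbrs.1 hy).1, by
      have := hlt y hy
      simp only [Set.mem_union, Set.mem_singleton_iff, Set.mem_ofPred_eq, hyx, false_or]
      omega⟩
  simp only [Set.mem_union, Set.mem_singleton_iff, Set.mem_ofPred_eq, not_or] at hsS htS
  obtain ⟨htx, ht⟩ := htS
  have htp : p t ≠ p v := hp.ne fun e => hv (e ▸ htW)
  have htq : q t ≠ q v := hq.ne fun e => hv (e ▸ htW)
  have hx' := hlt x hx
  -- If `t` is a neighbour of `v`, then `s` precedes `v` in both coordinates and is adjacent to `x`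
  -- as well. Otherwise `t` follows `v` in both coordinates; then `s = x`, and `t` is adjacent to
  -- every other neighbour of `v` too.
  by_cases htN : t ∈ N
  · rcases hsS with rfl | hs
    · exact absurd hst (hI _ hx _ htN)
    · have h1 := hgt t htN htx
      have h2 := hlt t htN
      refine ⟨x, hx, t, htN, Ne.symm htx, s, hsW, ?_, hst, ?_⟩
      all_goals rw [invGraph_adj] at *; omega
  · have htv : ¬ (invGraph p q).Adj v t := fun h => htN (mem_nbrs.2 ⟨htW, h⟩)
    rcases hsS with rfl | hs
    · have h1 := hgt y hy hyx
      have h2 := hlt y hy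
      refine ⟨s, hx, y, hy, Ne.symm hyx, t, htW, hst, ?_, htv⟩
      rw [invGraph_adj] at *; omega
    · rw [invGraph_adj] at hst htv; omega

/-- If a vertex has at least two, pairwise nonadjacent neighbours in an unseparated set, then two
of them have a common neighbour that is not adjacent to the vertex. -/
theorem exists_common_neighbor (hp : p.Injective) (hq : q.Injective) {W : Finset V} {v : V}
    (hW : Unseparated (invGraph p q) W) (hv : v ∉ W) (hN : (nbrs (invGraph p q) v W).Nontrivial)
    (hI : ∀ x ∈ nbrs (invGraph p q) v W, ∀ y ∈ nbrs (invGraph p q) v W,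
      ¬ (invGraph p q).Adj x y) :
    ∃ x ∈ nbrs (invGraph p q) v W, ∃ y ∈ nbrs (invGraph p q) v W, x ≠ y ∧
      ∃ z ∈ W, (invGraph p q).Adj x z ∧ (invGraph p q).Adj z y ∧ ¬ (invGraph p q).Adj v z := by
  obtain ⟨x, hx⟩ := hN.nonempty
  have hxv := invGraph_adj.1 (mem_nbrs.1 hx).2
  -- Points in the two opposite quadrants of neighbours would be adjacent, so only one quadrant is
  -- occupied; exchanging the coordinates swaps the two.
  rcases hxv with hxv | hxv
  · rw [← invGraph_swap] at *
    refine exists_common_neighbor_of_lt hq hp hW hv hN hI fun y hy => ?_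
    have h1 := (mem_nbrs.1 hy).2
    have h2 := hI x hx y hy
    rw [invGraph_adj] at h1 h2
    omega
  · refine exists_common_neighbor_of_lt hp hq hW hv hN hI fun y hy => ?_
    have h1 := (mem_nbrs.1 hy).2
    have h2 := hI x hx y hy
    rw [invGraph_adj] at h1 h2
    omega

/-- The graph has an induced cycle of length four. -/
def HasSquare (G : SimpleGraph V) : Prop :=
  ∃ v x z y, G.Adj v x ∧ G.Adj x z ∧ G.Adj z y ∧ G.Adj y v ∧ ¬ G.Adj v z ∧ ¬ G.Adj x y ∧
    v ≠ z ∧ x ≠ y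

theorem hasSquare_of_independent {p q : V → ℕ} (hp : p.Injective) (hq : q.Injective)
    {W : Finset V} {v : V} (hW : Unseparated (invGraph p q) W) (hv : v ∉ W)
    (hN : (nbrs (invGraph p q) v W).Nontrivial)
    (hI : ∀ x ∈ nbrs (invGraph p q) v W, ∀ y ∈ nbrs (invGraph p q) v W,
      ¬ (invGraph p q).Adj x y) : HasSquare (invGraph p q) := by
  obtain ⟨x, hx, y, hy, hxy, z, hz, hxz, hzy, hvz⟩ := exists_common_neighbor hp hq hW hv hN hI
  exact ⟨v, x, z, y, (mem_nbrs.1 hx).2, hxz, hzy, (mem_nbrs.1 hy).2.symm, hvz, hI x hx y hy,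
    fun e => hv (e ▸ hz), hxy⟩

end InversionGraph

/-! ### Possible values on connected graphs -/

section Growth

variable {V : Type*} [DecidableEq V] {G : SimpleGraph V} {f : Finset V → ℕ}

theorem IsSplitCount.unseparated (hf : IsSplitCount G f) {W : Finset V} (hW : f W ≠ 0) :
    Unseparated G W := by
  intro S hs ht
  by_contra! h
  exact hW (hf.eq_zero_of_separated S W hs ht h)

/-- A property that is preserved by adding adjacent vertices passes to the whole vertex set. -/
theorem Unseparated.induction [Fintype V] (hG : Unseparated G Finset.univ)
    (P : Finset V → Prop) {W₀ : Finset V} (h0 : W₀.Nonempty) (hP : P W₀)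
    (step : ∀ (W : Finset V) (v : V), W.Nonempty → v ∉ W → (nbrs G v W).Nonempty → P W →
      P (insert v W)) : P Finset.univ := by
  suffices h : ∀ k, ∀ W : Finset V, (Finset.univ \ W).card = k → W.Nonempty → P W →
      P Finset.univ from h _ W₀ rfl h0 hP
  intro k
  induction k with
  | zero =>
    intro W hk _ hPW
    have : W = Finset.univ := by
      simpa [Finset.sdiff_eq_empty_iff_subset, Finset.univ_subset_iff] using hk
    exact this ▸ hPW
  | succ k ih =>
    intro W hk hW hPW
    obtain ⟨t, ht⟩ : (Finset.univ \ W).Nonempty := Finset.card_pos.1 (by omega)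
    obtain ⟨w, hw⟩ := hW
    obtain ⟨s, -, hs, v, -, hv, hsv⟩ := hG (W : Set V) ⟨w, by simp, by simpa using hw⟩
      ⟨t, by simp, by simpa using ht⟩
    rw [Finset.mem_coe] at hs hv
    refine ih (insert v W) ?_ (by simp)
      (step W v ⟨w, hw⟩ hv ⟨s, mem_nbrs.2 ⟨hs, hsv.symm⟩⟩ hPW)
    rw [Finset.sdiff_insert, Finset.card_erase_of_mem (by simpa using hv), hk,
      Nat.add_sub_cancel]

theorem IsSplitCount.insert_of_card_eq_one (hf : IsSplitCount G f) {v : V} {W : Finset V}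
    (hW : W.Nonempty) (hv : v ∉ W) (h : (nbrs G v W).card = 1) : f (insert v W) = f W := by
  rw [hf.insert_of_clique hW hv, h, one_mul]
  intro x hx y hy hxy
  exact absurd (Finset.card_le_one.1 h.le x hx y hy) hxy

theorem IsSplitCount.ne_five_of_hasSquare [Fintype V] (hf : IsSplitCount G f)
    (hG : Unseparated G Finset.univ) (h : HasSquare G) : f Finset.univ ≠ 5 := by
  obtain ⟨v, x, z, y, h1, h2, h3, h4, h5, h6, h7, h8⟩ := h
  have := hG.induction (fun W => f W = 3 ∨ 6 ≤ f W) (W₀ := {v, x, z, y}) (by simp)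
    (Or.inl (hf.square h1 h2 h3 h4 h5 h6 h7 h8)) fun W v hW hv hN hP => by
      have hc := Finset.card_pos.2 hN
      have hm := hf.mul_le_insert hW hv
      by_cases h1 : (nbrs G v W).card = 1
      · rwa [hf.insert_of_card_eq_one hW hv h1]
      -- Two or more neighbours at least double a value that is at least 3.
      · have h2 : 2 * f W ≤ (nbrs G v W).card * f W := Nat.mul_le_mul_right _ (by omega)
        omega
  omega

theorem ne_five_of_triangle [Fintype V] {p q : V → ℕ} (hp : p.Injective) (hq : q.Injective)
    (hf : IsSplitCount (invGraph p q) f) (hG : Unseparated (invGraph p q) Finset.univ)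
    (hs : ¬ HasSquare (invGraph p q)) {a b c : V} (hab : (invGraph p q).Adj a b)
    (hbc : (invGraph p q).Adj b c) (hac : (invGraph p q).Adj a c) : f Finset.univ ≠ 5 := by
  have := hG.induction (fun W => f W = 2 ∨ f W = 4 ∨ 6 ≤ f W) (W₀ := {a, b, c}) (by simp)
    (Or.inl (hf.triangle hab hbc hac)) fun W v hW hv hN hP => by
      have hc := Finset.card_pos.2 hN
      have hm := hf.mul_le_insert hW hv
      rcases (by omega : (nbrs (invGraph p q) v W).card = 1 ∨
        (nbrs (invGraph p q) v W).card = 2 ∨ 3 ≤ (nbrs (invGraph p q) v W).card) with h1 | h2 | h3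
      · rwa [hf.insert_of_card_eq_one hW hv h1]
      · rw [h2] at hm
        obtain ⟨x, y, hxy, hNe⟩ := Finset.card_eq_two.1 h2
        by_cases hadj : (invGraph p q).Adj x y
        · rw [hf.insert_of_clique hW hv, h2]
          · omega
          · simp only [hNe, Finset.mem_insert, Finset.mem_singleton]
            rintro s (rfl | rfl) t (rfl | rfl) hst
            · exact absurd rfl hst
            · exact hadj
            · exact hadj.symm
            · exact absurd rfl hst
        · refine absurd (hasSquare_of_independent hp hq (hf.unseparated (by omega)) hv ?_ ?_) hs
          · exact Finset.one_lt_card_iff_nontrivial.1 (by omega)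
          · simp only [hNe, Finset.mem_insert, Finset.mem_singleton]
            rintro s (rfl | rfl) t (rfl | rfl) hst
            · exact hst.ne rfl
            · exact hadj hst
            · exact hadj hst.symm
            · exact hst.ne rfl
      -- Three or more neighbours at least triple a value that is at least 2; this skips 5.
      · have h2 : 3 * f W ≤ (nbrs (invGraph p q) v W).card * f W := Nat.mul_le_mul_right _ h3
        omega
  omega

theorem eq_one_of_triangleFree [Fintype V] [Nonempty V] {p q : V → ℕ} (hp : p.Injective)
    (hq : q.Injective) (hf : IsSplitCount (invGraph p q) f)
    (hG : Unseparated (invGraph p q) Finset.univ) (hs : ¬ HasSquare (invGraph p q))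
    (ht : ∀ a b c, (invGraph p q).Adj a b → (invGraph p q).Adj b c → ¬ (invGraph p q).Adj a c) :
    f Finset.univ = 1 := by
  refine hG.induction (fun W => f W = 1) (W₀ := {Classical.arbitrary V}) (by simp)
    (hf.singleton _) fun W v hW hv hN hP => ?_
  have hc := Finset.card_pos.2 hN
  by_cases h1 : (nbrs (invGraph p q) v W).card = 1
  · rwa [hf.insert_of_card_eq_one hW hv h1]
  · refine absurd (hasSquare_of_independent hp hq (hf.unseparated (by omega)) hv
      (Finset.one_lt_card_iff_nontrivial.1 (by omega)) fun x hx y hy hxy => ?_) hs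
    exact ht v x y (mem_nbrs.1 hx).2 hxy (mem_nbrs.1 hy).2

theorem IsSplitCount.ne_five [Fintype V] [Nonempty V] {p q : V → ℕ} (hp : p.Injective)
    (hq : q.Injective) (hf : IsSplitCount (invGraph p q) f) : f Finset.univ ≠ 5 := by
  intro h5
  have hG : Unseparated (invGraph p q) Finset.univ := hf.unseparated (by omega)
  by_cases hs : HasSquare (invGraph p q)
  · exact hf.ne_five_of_hasSquare hG hs h5
  · by_cases ht : ∃ a b c, (invGraph p q).Adj a b ∧ (invGraph p q).Adj b c ∧
        (invGraph p q).Adj a c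
    · obtain ⟨a, b, c, hab, hbc, hac⟩ := ht
      exact ne_five_of_triangle hp hq hf hG hs hab hbc hac h5
    · push Not at ht
      have := eq_one_of_triangleFree hp hq hf hG hs ht
      omega

end Growth

/-! ### CNATs with rows and columns labelled by their leaves -/

section CnatsOn

variable {V : Type*} {p q : V → ℕ} {W A : Finset V} {T T₁ T₂ : Finset (V × V)} {a b k j : V}

/-- The cell in row `k` and column `j` has a dot above it; rows are ordered by `q`. -/
def DotAbove (q : V → ℕ) (T : Finset (V × V)) (k j : V) : Prop := ∃ k', q k' < q k ∧ (k', j) ∈ T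

/-- The cell in row `k` and column `j` has a dot to its left; columns are ordered by `p`. -/
def DotLeft (p : V → ℕ) (T : Finset (V × V)) (k j : V) : Prop := ∃ j', p j' < p j ∧ (k, j') ∈ T

/-- The set `T` of dots is a CNAT on the rows and columns indexed by `W`, with columns ordered by
`p` and rows ordered by `q`, whose leaf dots are the diagonal cells. -/
structure IsCnatOn (p q : V → ℕ) (W : Finset V) (T : Finset (V × V)) : Prop where
  row_mem : ∀ k j, (k, j) ∈ T → k ∈ W
  col_mem : ∀ k j, (k, j) ∈ T → j ∈ W
  row_le : ∀ k j, (k, j) ∈ T → q k ≤ q j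
  col_le : ∀ k j, (k, j) ∈ T → p j ≤ p k
  leaf : ∀ j ∈ W, (j, j) ∈ T
  parent : ∀ k j, (k, j) ∈ T → (∀ w ∈ W, q k ≤ q w ∧ p j ≤ p w) ∨
    Xor (DotAbove q T k j) (DotLeft p T k j)

/-- The points `a` and `b` of `W` determine the first column and the first row. -/
structure IsFirstCell (p q : V → ℕ) (W : Finset V) (a b : V) : Prop where
  inj_col : p.Injective
  inj_row : q.Injective
  mem_col : a ∈ W
  mem_row : b ∈ W
  col_le : ∀ w ∈ W, p a ≤ p w
  row_le : ∀ w ∈ W, q b ≤ q w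

theorem exists_isFirstCell (hp : p.Injective) (hq : q.Injective) (hW : W.Nonempty) :
    ∃ a b, IsFirstCell p q W a b := by
  obtain ⟨a, ha, ha'⟩ := W.exists_min_image p hW
  obtain ⟨b, hb, hb'⟩ := W.exists_min_image q hW
  exact ⟨a, b, hp, hq, ha, hb, ha', hb'⟩

theorem IsFirstCell.col_eq (h : IsFirstCell p q W a b) (hj : j ∈ W) (hle : p j ≤ p a) : j = a :=
  h.inj_col (le_antisymm hle (h.col_le j hj))

theorem IsFirstCell.row_eq (h : IsFirstCell p q W a b) (hk : k ∈ W) (hle : q k ≤ q b) : k = b :=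
  h.inj_row (le_antisymm hle (h.row_le k hk))

namespace IsCnatOn

theorem parent_of_ne (h : IsCnatOn p q W T) (hc : IsFirstCell p q W a b) (hT : (k, j) ∈ T)
    (hne : ¬ (k = b ∧ j = a)) : Xor (DotAbove q T k j) (DotLeft p T k j) :=
  (h.parent k j hT).resolve_left fun hw => hne
    ⟨hc.row_eq (h.row_mem _ _ hT) (hw b hc.mem_row).1,
      hc.col_eq (h.col_mem _ _ hT) (hw a hc.mem_col).2⟩

theorem not_above_and_left (h : IsCnatOn p q W T) (hT : (k, j) ∈ T) :
    ¬ (DotAbove q T k j ∧ DotLeft p T k j) := by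
  rintro ⟨⟨k', hk', hT'⟩, hl⟩
  rcases h.parent k j hT with hw | hx
  · have := (hw k' (h.row_mem _ _ hT')).1
    omega
  · rcases hx with ⟨_, h2⟩ | ⟨_, h2⟩
    · exact h2 hl
    · exact h2 ⟨k', hk', hT'⟩

theorem root_mem (h : IsCnatOn p q W T) (hc : IsFirstCell p q W a b) : (b, a) ∈ T := by
  obtain ⟨⟨k, j⟩, hT, hmin⟩ := T.exists_min_image (fun x => q x.1 + p x.2)
    ⟨(a, a), h.leaf a hc.mem_col⟩
  by_cases hne : k = b ∧ j = a
  · rwa [← hne.1, ← hne.2]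
  · rcases h.parent_of_ne hc hT hne with ⟨⟨k', h1, h2⟩, _⟩ | ⟨⟨j', h1, h2⟩, _⟩
    · have := hmin _ h2
      simp only at this; omega
    · have := hmin _ h2
      simp only at this; omega

/-- If `a = b`, the root is itself a leaf, so no dot lies below it or to its right. But a further
dot with minimal coordinate sum would have the root as its parent. -/
theorem corner_ne (h : IsCnatOn p q W T) (hW : W.Nontrivial) (hc : IsFirstCell p q W a b) :
    a ≠ b := by
  rintro rfl
  classical
  obtain ⟨x, hx, hxa⟩ := hW.exists_ne a
  obtain ⟨⟨k, j⟩, hT, hmin⟩ := (T.erase (a, a)).exists_min_image (fun x => q x.1 + p x.2)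
    ⟨(x, x), by simp [hxa, h.leaf x hx]⟩
  rw [Finset.mem_erase, ne_eq, Prod.mk.injEq] at hT
  have key : ∀ k' j', (k', j') ∈ T → q k' + p j' < q k + p j → k' = a ∧ j' = a := by
    intro k' j' h1 h2
    by_contra hne
    have := hmin (k', j') (Finset.mem_erase.2 ⟨by rwa [ne_eq, Prod.mk.injEq], h1⟩)
    simp only at this; omega
  have hr := h.row_le _ _ hT.2
  have hl := h.col_le _ _ hT.2
  rcases h.parent_of_ne hc hT.2 hT.1 with ⟨⟨k', h1, h2⟩, _⟩ | ⟨⟨j', h1, h2⟩, _⟩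
  · obtain ⟨rfl, rfl⟩ := key _ _ h2 (by omega)
    omega
  · obtain ⟨rfl, rfl⟩ := key _ _ h2 (by omega)
    omega

end IsCnatOn

/-! ### Cutting a CNAT at its root -/

/-- The dots of `T` that descend from the root `(b, a)` through the first column. -/
inductive Descends (p q : V → ℕ) (a b : V) (T : Finset (V × V)) : V → V → Prop
  | base (k : V) : (k, a) ∈ T → k ≠ b → Descends p q a b T k a
  | down (k k' j : V) : Descends p q a b T k' j → q k' < q k → (k, j) ∈ T → Descends p q a b T k j
  | right (k j' j : V) : Descends p q a b T k j' → p j' < p j → (k, j) ∈ T → Descends p q a b T k j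

namespace Descends

theorem mem (hd : Descends p q a b T k j) : (k, j) ∈ T := by
  cases hd <;> assumption

theorem row_ne (hd : Descends p q a b T k j) (h : IsCnatOn p q W T) (hc : IsFirstCell p q W a b) :
    k ≠ b := by
  induction hd with
  | base k _ hk => exact hk
  | down k k' j hd hlt hT ih =>
    rintro rfl
    have := hc.row_le _ (h.row_mem _ _ hd.mem)
    omega
  | right k j' j hd hlt hT ih => exact ih

/-- A dot reached by a step to the right has a dot on its left, hence none above it. It is the top
of its column, and the other dots there descend from it. Excluding row `b` keeps out the root. -/
theorem same_col (hd : Descends p q a b T k j) (h : IsCnatOn p q W T)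
    (hc : IsFirstCell p q W a b) {k₂ : V} (hT₂ : (k₂, j) ∈ T) (hb : k₂ ≠ b) :
    Descends p q a b T k₂ j := by
  induction hd with
  | base k _ hk => exact base _ hT₂ hb
  | down k k' j hd hlt hT ih => exact ih hT₂
  | right k j' j hd hlt hT ih =>
    rcases lt_trichotomy (q k₂) (q k) with hq | hq | hq
    · exact absurd ⟨⟨k₂, hq, hT₂⟩, ⟨j', hlt, hd.mem⟩⟩ (h.not_above_and_left hT)
    · rw [hc.inj_row hq]; exact right k j' j hd hlt hT
    · exact down _ k _ (right k j' j hd hlt hT) hq hT₂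

theorem same_row (hd : Descends p q a b T k j) (h : IsCnatOn p q W T)
    (hc : IsFirstCell p q W a b) {j₂ : V} (hT₂ : (k, j₂) ∈ T) :
    Descends p q a b T k j₂ := by
  induction hd with
  | base k hT hk =>
    rcases lt_or_eq_of_le (hc.col_le _ (h.col_mem _ _ hT₂)) with hq | hq
    · exact right _ a _ (base k hT hk) hq hT₂
    · rw [← hc.inj_col hq]; exact base k hT hk
  | right k j' j hd hlt hT ih => exact ih hT₂
  | down k k' j hd hlt hT ih =>
    rcases lt_trichotomy (p j₂) (p j) with hq | hq | hq
    · exact absurd ⟨⟨k', hlt, hd.mem⟩, ⟨j₂, hq, hT₂⟩⟩ (h.not_above_and_left hT)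
    · rw [hc.inj_col hq]; exact down k k' j hd hlt hT
    · exact right _ j _ (down k k' j hd hlt hT) hq hT₂

theorem first_row_notMem (hd : Descends p q a b T k j) (h : IsCnatOn p q W T)
    (hc : IsFirstCell p q W a b) (hj : j ≠ a) : (b, j) ∉ T := by
  intro hT₂
  induction hd with
  | base k _ hk => exact hj rfl
  | down k k' j hd hlt hT ih => exact ih hj hT₂
  | right k j' j hd hlt hT ih =>
    have hk := hd.row_ne h hc
    have := lt_of_le_of_ne (hc.row_le _ (h.row_mem _ _ hT)) (hc.inj_row.ne hk.symm)
    exact h.not_above_and_left hT ⟨⟨b, this, hT₂⟩, ⟨j', hlt, hd.mem⟩⟩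

/-- Together with `iff_row`: a dot outside row `b` descends through the first column exactly when
the leaves of its row and of its column do. Thus a set of leaves encodes the whole subtree. -/
theorem iff_col (h : IsCnatOn p q W T) (hc : IsFirstCell p q W a b) (hT : (k, j) ∈ T) (hk : k ≠ b) :
    Descends p q a b T j j ↔ Descends p q a b T k j := by
  refine ⟨fun hd => hd.same_col h hc hT hk, fun hd => ?_⟩
  refine hd.same_col h hc (h.leaf _ (h.col_mem _ _ hT)) ?_
  rintro rfl
  exact hk (hc.row_eq (h.row_mem _ _ hT) (h.row_le _ _ hT))

theorem iff_row (h : IsCnatOn p q W T) (hc : IsFirstCell p q W a b) (hT : (k, j) ∈ T) :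
    Descends p q a b T k k ↔ Descends p q a b T k j :=
  ⟨fun hd => hd.same_row h hc hT, fun hd => hd.same_row h hc (h.leaf _ (h.row_mem _ _ hT))⟩

end Descends

/-- The removed root can be a parent only in column `a`. There the topmost remaining dot becomes the
new root, and all other parents survive. -/
theorem IsCnatOn.isCnatOn_descendants (h : IsCnatOn p q W T) (hc : IsFirstCell p q W a b)
    (hAW : A ⊆ W)
    (hA : ∀ w ∈ W, w ∈ A ↔ Descends p q a b T w w)
    (hT₁ : ∀ k j, (k, j) ∈ T₁ ↔ (k, j) ∈ T ∧ k ∈ A ∧ j ∈ A) : IsCnatOn p q A T₁ := by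
  have hbA : b ∉ A := fun hb => ((hA b hc.mem_row).1 hb).row_ne h hc rfl
  refine ⟨fun k j hT => ((hT₁ k j).1 hT).2.1, fun k j hT => ((hT₁ k j).1 hT).2.2,
    fun k j hT => h.row_le k j ((hT₁ k j).1 hT).1, fun k j hT => h.col_le k j ((hT₁ k j).1 hT).1,
    fun j hj => (hT₁ j j).2 ⟨h.leaf j (hAW hj), hj, hj⟩, ?_⟩
  intro k j hkj
  obtain ⟨hT, hk, hj⟩ := (hT₁ k j).1 hkj
  have hkb : k ≠ b := fun e => hbA (e ▸ hk)
  have hx := h.parent_of_ne hc hT fun e => hkb e.1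
  have hleft : DotLeft p T k j ↔ DotLeft p T₁ k j := by
    constructor
    · rintro ⟨j', h1, h2⟩
      refine ⟨j', h1, (hT₁ _ _).2 ⟨h2, hk, ?_⟩⟩
      rw [hA _ (h.col_mem _ _ h2), Descends.iff_col h hc h2 hkb, ← Descends.iff_row h hc h2]
      exact (hA _ (hAW hk)).1 hk
    · rintro ⟨j', h1, h2⟩
      exact ⟨j', h1, ((hT₁ _ _).1 h2).1⟩
  have habove : ∀ k', k' ≠ b → (k', j) ∈ T → (k', j) ∈ T₁ := by
    intro k' hk' h2
    refine (hT₁ _ _).2 ⟨h2, ?_, hj⟩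
    rw [hA _ (h.row_mem _ _ h2), Descends.iff_row h hc h2, ← Descends.iff_col h hc h2 hk']
    exact (hA _ (hAW hj)).1 hj
  by_cases hja : j = a
  · subst hja
    have hnl : ¬ DotLeft p T₁ k j := by
      rintro ⟨j', h1, h2⟩
      have := hc.col_le _ (h.col_mem _ _ ((hT₁ _ _).1 h2).1)
      omega
    by_cases hab : DotAbove q T₁ k j
    · exact Or.inr (Or.inl ⟨hab, hnl⟩)
    · refine Or.inl fun w hw => ⟨?_, hc.col_le w (hAW hw)⟩
      -- Descent only goes down or right, so no descendant lies above the top dot of the first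
      -- column.
      have : ∀ k' j', Descends p q j b T k' j' → q k ≤ q k' := by
        intro k' j' hd
        induction hd with
        | base k' hT' hk' =>
          by_contra hlt
          exact hab ⟨k', by omega, habove k' hk' hT'⟩
        | down k' k'' j' hd hlt hT' ih => omega
        | right k' j'' j' hd hlt hT' ih => exact ih
      exact this w w ((hA w (hAW hw)).1 hw)
  · right
    have : DotAbove q T k j ↔ DotAbove q T₁ k j := by
      constructor
      · rintro ⟨k', h1, h2⟩
        refine ⟨k', h1, habove k' ?_ h2⟩
        rintro rfl
        exact ((hA _ (hAW hj)).1 hj).first_row_notMem h hc hja h2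
      · rintro ⟨k', h1, h2⟩
        exact ⟨k', h1, ((hT₁ _ _).1 h2).1⟩
    rwa [hleft, this] at hx

theorem IsCnatOn.isCnatOn_nondescendants [DecidableEq V] (h : IsCnatOn p q W T) (hc : IsFirstCell p q W a b)
    (hab : a ≠ b) (hA : ∀ w ∈ W, w ∈ A ↔ Descends p q a b T w w)
    (hT₂ : ∀ k j, (k, j) ∈ T₂ ↔ (k, j) ∈ T ∧ k ∉ A ∧ j ∉ A) : IsCnatOn p q (W \ A) T₂ := by
  have haA : a ∈ A := (hA a hc.mem_col).2 (.base a (h.leaf a hc.mem_col) hab)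
  have hbA : b ∉ A := fun hb => ((hA b hc.mem_row).1 hb).row_ne h hc rfl
  refine ⟨fun k j hT => ?_, fun k j hT => ?_, fun k j hT => h.row_le k j ((hT₂ k j).1 hT).1,
    fun k j hT => h.col_le k j ((hT₂ k j).1 hT).1, fun j hj => ?_, ?_⟩
  · exact Finset.mem_sdiff.2 ⟨h.row_mem _ _ ((hT₂ k j).1 hT).1, ((hT₂ k j).1 hT).2.1⟩
  · exact Finset.mem_sdiff.2 ⟨h.col_mem _ _ ((hT₂ k j).1 hT).1, ((hT₂ k j).1 hT).2.2⟩
  · rw [Finset.mem_sdiff] at hj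
    exact (hT₂ j j).2 ⟨h.leaf j hj.1, hj.2, hj.2⟩
  intro k j hkj
  obtain ⟨hT, hk, hj⟩ := (hT₂ k j).1 hkj
  have hja : j ≠ a := fun e => hj (e ▸ haA)
  have hx := h.parent_of_ne hc hT fun e => hja e.2
  have habove : DotAbove q T k j ↔ DotAbove q T₂ k j := by
    constructor
    · rintro ⟨k', h1, h2⟩
      refine ⟨k', h1, (hT₂ _ _).2 ⟨h2, ?_, hj⟩⟩
      by_cases hk' : k' = b
      · rwa [hk']
      · rw [hA _ (h.row_mem _ _ h2), Descends.iff_row h hc h2, ← Descends.iff_col h hc h2 hk',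
          ← hA _ (h.col_mem _ _ h2)]
        exact hj
    · rintro ⟨k', h1, h2⟩
      exact ⟨k', h1, ((hT₂ _ _).1 h2).1⟩
  by_cases hkb : k = b
  · subst hkb
    have hna : ¬ DotAbove q T₂ k j := by
      rintro ⟨k', h1, h2⟩
      have := hc.row_le _ (h.row_mem _ _ ((hT₂ _ _).1 h2).1)
      omega
    by_cases hl : DotLeft p T₂ k j
    · exact Or.inr (Or.inr ⟨hl, hna⟩)
    · refine Or.inl fun w hw => ?_
      rw [Finset.mem_sdiff] at hw
      refine ⟨hc.row_le w hw.1, ?_⟩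
      have hrow : ∀ j', (k, j') ∈ T → j' ≠ a → p j ≤ p j' := by
        intro j' hT' hja'
        by_contra hlt
        refine hl ⟨j', by omega, (hT₂ _ _).2 ⟨hT', hbA, fun hj' => ?_⟩⟩
        exact ((hA _ (h.col_mem _ _ hT')).1 hj').first_row_notMem h hc hja' hT'
      -- Not descending is not an inductive predicate, so climb from a dot to its parent, which does
      -- not descend either, until row `b` is reached.
      have : ∀ n k' j', q k' + p j' = n → (k', j') ∈ T → ¬ (k' = k ∧ j' = a) →
          ¬ Descends p q a k T k' j' → p j ≤ p j' := by
        intro n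
        induction n using Nat.strong_induction_on with
        | _ n ih =>
          intro k' j' hn hT' hne hd
          by_cases hk' : k' = k
          · subst hk'
            exact hrow j' hT' fun e => hne ⟨rfl, e⟩
          · have hj' : j' ≠ a := by
              rintro rfl
              exact hd (.base k' hT' hk')
            rcases h.parent_of_ne hc hT' hne with ⟨⟨k'', h1, h2⟩, _⟩ | ⟨⟨j'', h1, h2⟩, _⟩
            · exact ih _ (by omega) k'' j' rfl h2 (fun e => hj' e.2)
                fun hd' => hd (.down _ _ _ hd' h1 hT')
            · exact (ih _ (by omega) k' j'' rfl h2 (fun e => hk' e.1)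
                fun hd' => hd (.right _ _ _ hd' h1 hT')).trans h1.le
      refine this _ w w rfl (h.leaf w hw.1) (fun e => hab (e.2.symm.trans e.1)) ?_
      rw [← hA w hw.1]
      exact hw.2
  · right
    have : DotLeft p T k j ↔ DotLeft p T₂ k j := by
      constructor
      · rintro ⟨j', h1, h2⟩
        refine ⟨j', h1, (hT₂ _ _).2 ⟨h2, hk, ?_⟩⟩
        rw [hA _ (h.col_mem _ _ h2), Descends.iff_col h hc h2 hkb, ← Descends.iff_row h hc h2,
          ← hA _ (h.row_mem _ _ h2)]
        exact hk
      · rintro ⟨j', h1, h2⟩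
        exact ⟨j', h1, ((hT₂ _ _).1 h2).1⟩
    rwa [habove, this] at hx

/-! ### Gluing two CNATs below a new root -/

section Glue

variable [DecidableEq V]

/-- The part on `A` avoids row `b` and the other part avoids column `a`. So the new root lies above
dots of `T₁` in column `a` only and left of dots of `T₂` in row `b` only, where it supplies the
parent that the two old roots lacked. -/
theorem IsCnatOn.glue (hc : IsFirstCell p q W a b) (hAW : A ⊆ W) (ha : a ∈ A) (hb : b ∉ A)
    (h₁ : IsCnatOn p q A T₁) (h₂ : IsCnatOn p q (W \ A) T₂) :
    IsCnatOn p q W (insert (b, a) (T₁ ∪ T₂)) := by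
  have hmem : ∀ k j, (k, j) ∈ insert (b, a) (T₁ ∪ T₂) ↔
      (k = b ∧ j = a) ∨ (k, j) ∈ T₁ ∨ (k, j) ∈ T₂ := by
    intro k j; simp
  have hW : ∀ {x}, x ∈ W \ A → x ∈ W ∧ x ∉ A := Finset.mem_sdiff.1
  constructor
  · intro k j hT
    rcases (hmem k j).1 hT with ⟨rfl, rfl⟩ | hT | hT
    · exact hc.mem_row
    · exact hAW (h₁.row_mem _ _ hT)
    · exact (hW (h₂.row_mem _ _ hT)).1
  · intro k j hT
    rcases (hmem k j).1 hT with ⟨rfl, rfl⟩ | hT | hT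
    · exact hc.mem_col
    · exact hAW (h₁.col_mem _ _ hT)
    · exact (hW (h₂.col_mem _ _ hT)).1
  · intro k j hT
    rcases (hmem k j).1 hT with ⟨rfl, rfl⟩ | hT | hT
    · exact hc.row_le _ hc.mem_col
    · exact h₁.row_le _ _ hT
    · exact h₂.row_le _ _ hT
  · intro k j hT
    rcases (hmem k j).1 hT with ⟨rfl, rfl⟩ | hT | hT
    · exact hc.col_le _ hc.mem_row
    · exact h₁.col_le _ _ hT
    · exact h₂.col_le _ _ hT
  · intro j hj
    by_cases hjA : j ∈ A
    · exact (hmem j j).2 (Or.inr (Or.inl (h₁.leaf j hjA)))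
    · exact (hmem j j).2 (Or.inr (Or.inr (h₂.leaf j (Finset.mem_sdiff.2 ⟨hj, hjA⟩))))
  · intro k j hT
    rcases (hmem k j).1 hT with ⟨rfl, rfl⟩ | hT | hT
    · exact Or.inl fun w hw => ⟨hc.row_le w hw, hc.col_le w hw⟩
    · right
      have hk := h₁.row_mem _ _ hT
      have hj := h₁.col_mem _ _ hT
      have hleft : DotLeft p (insert (b, a) (T₁ ∪ T₂)) k j ↔ DotLeft p T₁ k j := by
        refine exists_congr fun j' => and_congr_right fun _ => ?_
        rw [hmem]
        refine ⟨?_, fun h => Or.inr (Or.inl h)⟩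
        rintro (⟨rfl, -⟩ | h | h)
        · exact absurd hk hb
        · exact h
        · exact absurd hk (hW (h₂.row_mem _ _ h)).2
      have habove : DotAbove q (insert (b, a) (T₁ ∪ T₂)) k j ↔ j = a ∨ DotAbove q T₁ k j := by
        constructor
        · rintro ⟨k', h1, h2⟩
          rcases (hmem _ _).1 h2 with ⟨-, rfl⟩ | h | h
          · exact Or.inl rfl
          · exact Or.inr ⟨k', h1, h⟩
          · exact absurd hj (hW (h₂.col_mem _ _ h)).2
        · rintro (rfl | ⟨k', h1, h2⟩)
          · refine ⟨b, lt_of_le_of_ne (hc.row_le k (hAW hk)) (hc.inj_row.ne ?_), by simp⟩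
            rintro rfl; exact hb hk
          · exact ⟨k', h1, (hmem _ _).2 (Or.inr (Or.inl h2))⟩
      have hnl : j = a → ¬ DotLeft p T₁ k j := by
        rintro rfl ⟨j', h1, h2⟩
        have := hc.col_le _ (hAW (h₁.col_mem _ _ h2))
        omega
      rw [hleft, habove]
      rcases h₁.parent k j hT with hw | hx
      · have hja : j = a := hc.col_eq (hAW hj) (hw a ha).2
        exact Or.inl ⟨Or.inl hja, hnl hja⟩
      · rcases hx with ⟨h1, h2⟩ | ⟨h1, h2⟩
        · exact Or.inl ⟨Or.inr h1, h2⟩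
        · exact Or.inr ⟨h1, fun h => h.elim (fun e => hnl e h1) h2⟩
    · right
      have hk := hW (h₂.row_mem _ _ hT)
      have hj := hW (h₂.col_mem _ _ hT)
      have habove : DotAbove q (insert (b, a) (T₁ ∪ T₂)) k j ↔ DotAbove q T₂ k j := by
        refine exists_congr fun j' => and_congr_right fun _ => ?_
        rw [hmem]
        refine ⟨?_, fun h => Or.inr (Or.inr h)⟩
        rintro (⟨-, rfl⟩ | h | h)
        · exact absurd ha hj.2
        · exact absurd (h₁.col_mem _ _ h) hj.2
        · exact h
      have hleft : DotLeft p (insert (b, a) (T₁ ∪ T₂)) k j ↔ k = b ∨ DotLeft p T₂ k j := by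
        constructor
        · rintro ⟨j', h1, h2⟩
          rcases (hmem _ _).1 h2 with ⟨rfl, -⟩ | h | h
          · exact Or.inl rfl
          · exact absurd (h₁.row_mem _ _ h) hk.2
          · exact Or.inr ⟨j', h1, h⟩
        · rintro (rfl | ⟨k', h1, h2⟩)
          · refine ⟨a, lt_of_le_of_ne (hc.col_le j hj.1) (hc.inj_col.ne ?_), by simp⟩
            rintro rfl; exact hj.2 ha
          · exact ⟨k', h1, (hmem _ _).2 (Or.inr (Or.inr h2))⟩
      have hna : k = b → ¬ DotAbove q T₂ k j := by
        rintro rfl ⟨k', h1, h2⟩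
        have := hc.row_le _ (hW (h₂.row_mem _ _ h2)).1
        omega
      rw [hleft, habove]
      rcases h₂.parent k j hT with hw | hx
      · have hkb : k = b := hc.row_eq hk.1 (hw b (Finset.mem_sdiff.2 ⟨hc.mem_row, hb⟩)).1
        exact Or.inr ⟨Or.inl hkb, hna hkb⟩
      · rcases hx with ⟨h1, h2⟩ | ⟨h1, h2⟩
        · exact Or.inl ⟨h1, fun h => h.elim (fun e => hna e h1) h2⟩
        · exact Or.inr ⟨Or.inr h1, h2⟩

/-- The glued filling determines the leaf sets: along parent links in `T₁`, starting from its root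
in column `a`, rows and columns never leave `A'`, because no dot of either new part mixes `A'` with
its complement. -/
theorem IsCnatOn.glue_part_subset {A' : Finset V} {T₁' T₂' : Finset (V × V)}
    (hc : IsFirstCell p q W a b) (hAW : A ⊆ W) (ha : a ∈ A) (hb : b ∉ A) (ha' : a ∈ A')
    (h₁ : IsCnatOn p q A T₁) (h₁' : IsCnatOn p q A' T₁') (h₂' : IsCnatOn p q (W \ A') T₂')
    (he : insert (b, a) (T₁ ∪ T₂) = insert (b, a) (T₁' ∪ T₂')) : A ⊆ A' := by
  have hT : ∀ k j, (k, j) ∈ T₁ → (k, j) ∈ T₁' ∨ (k, j) ∈ T₂' := by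
    intro k j hT
    have hm : (k, j) ∈ insert (b, a) (T₁' ∪ T₂') := by
      rw [← he]; simp [hT]
    have hkb : k ≠ b := by
      rintro rfl
      exact hb (h₁.row_mem _ _ hT)
    simpa [hkb] using hm
  have key : ∀ n k j, q k + p j = n → (k, j) ∈ T₁ → j ∈ A' := by
    intro n
    induction n using Nat.strong_induction_on with
    | _ n ih =>
      intro k j hn hkj
      rcases h₁.parent k j hkj with hw | ⟨⟨k', h1, h2⟩, _⟩ | ⟨⟨j', h1, h2⟩, _⟩
      · rwa [hc.col_eq (hAW (h₁.col_mem _ _ hkj)) (hw a ha).2]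
      · exact ih _ (by omega) k' j rfl h2
      · have hj' := ih _ (by omega) k j' rfl h2
        have hk : k ∈ A' := by
          rcases hT _ _ h2 with h | h
          · exact h₁'.row_mem _ _ h
          · exact absurd hj' (Finset.mem_sdiff.1 (h₂'.col_mem _ _ h)).2
        rcases hT _ _ hkj with h | h
        · exact h₁'.col_mem _ _ h
        · exact absurd hk (Finset.mem_sdiff.1 (h₂'.row_mem _ _ h)).2
  exact fun x hx => key _ x x rfl (h₁.leaf x hx)

theorem IsCnatOn.glue_filter_left (hb : b ∉ A)
    (h₁ : IsCnatOn p q A T₁) (h₂ : IsCnatOn p q (W \ A) T₂) :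
    (insert (b, a) (T₁ ∪ T₂)).filter (fun x => x.1 ∈ A) = T₁ := by
  ext ⟨k, j⟩
  simp only [Finset.mem_filter, Finset.mem_insert, Finset.mem_union, Prod.mk.injEq]
  constructor
  · rintro ⟨⟨rfl, -⟩ | h | h, hk⟩
    · exact absurd hk hb
    · exact h
    · exact absurd hk (Finset.mem_sdiff.1 (h₂.row_mem _ _ h)).2
  · exact fun h => ⟨Or.inr (Or.inl h), h₁.row_mem _ _ h⟩

theorem IsCnatOn.glue_filter_right (ha : a ∈ A) (h₁ : IsCnatOn p q A T₁)
    (h₂ : IsCnatOn p q (W \ A) T₂) :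
    (insert (b, a) (T₁ ∪ T₂)).filter (fun x => x.2 ∉ A) = T₂ := by
  ext ⟨k, j⟩
  simp only [Finset.mem_filter, Finset.mem_insert, Finset.mem_union, Prod.mk.injEq]
  constructor
  · rintro ⟨⟨-, rfl⟩ | h | h, hk⟩
    · exact absurd ha hk
    · exact absurd (h₁.col_mem _ _ h) hk
    · exact h
  · exact fun h => ⟨Or.inr (Or.inr h), (Finset.mem_sdiff.1 (h₂.col_mem _ _ h)).2⟩

end Glue

end CnatsOn

/-! ### The number of CNATs is a split count -/

section CnatCount

variable {V : Type*} {p q : V → ℕ} {W A : Finset V} {a b : V}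

open Classical in
/-- The CNATs on the rows and columns indexed by `W`. -/
noncomputable def cnatsOn (p q : V → ℕ) (W : Finset V) : Finset (Finset (V × V)) :=
  (W ×ˢ W).powerset.filter (IsCnatOn p q W)

theorem mem_cnatsOn {T : Finset (V × V)} : T ∈ cnatsOn p q W ↔ IsCnatOn p q W T := by
  classical
  simp only [cnatsOn, Finset.mem_filter, Finset.mem_powerset, and_iff_right_iff_imp]
  rintro h ⟨k, j⟩ hT
  exact Finset.mem_product.2 ⟨h.row_mem _ _ hT, h.col_mem _ _ hT⟩

theorem IsFirstCell.mono {X : Finset V} (hc : IsFirstCell p q W a b) (hX : X ⊆ W) (ha : a ∈ X)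
    (hb : b ∈ X) : IsFirstCell p q X a b :=
  ⟨hc.inj_col, hc.inj_row, ha, hb, fun w hw => hc.col_le w (hX hw),
    fun w hw => hc.row_le w (hX hw)⟩

theorem IsFirstCell.adj (hc : IsFirstCell p q W a b) (hab : a ≠ b) : (invGraph p q).Adj a b := by
  have h1 := hc.col_le b hc.mem_row
  have h2 := hc.row_le a hc.mem_col
  have h3 := hc.inj_col.ne hab
  have h4 := hc.inj_row.ne hab
  rw [invGraph_adj]; omega

theorem card_cnatsOn_singleton (v : V) : (cnatsOn p q {v}).card = 1 := by
  rw [Finset.card_eq_one]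
  refine ⟨{(v, v)}, ?_⟩
  ext T
  rw [mem_cnatsOn, Finset.mem_singleton]
  constructor
  · intro h
    ext ⟨k, j⟩
    simp only [Finset.mem_singleton, Prod.mk.injEq]
    constructor
    · exact fun hT => ⟨by simpa using h.row_mem _ _ hT, by simpa using h.col_mem _ _ hT⟩
    · rintro ⟨rfl, rfl⟩; exact h.leaf _ (by simp)
  · rintro rfl
    constructor <;> simp

theorem card_cnatsOn_eq_zero (hW : W.Nontrivial) (hc : IsFirstCell p q W a a) :
    (cnatsOn p q W).card = 0 := by
  rw [Finset.card_eq_zero, Finset.eq_empty_iff_forall_notMem]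
  exact fun T hT => (mem_cnatsOn.1 hT).corner_ne hW hc rfl

variable [DecidableEq V]

/-- A CNAT is obtained from its root and the two subtrees of the root. -/
theorem card_cnatsOn_eq_splitSum (hc : IsFirstCell p q W a b) (hab : a ≠ b) :
    (cnatsOn p q W).card = splitSum (fun W => (cnatsOn p q W).card) W a b := by
  classical
  rw [splitSum, ← Finset.sum_filter]
  simp only [← Finset.card_product]
  rw [← Finset.card_sigma]
  symm
  refine Finset.card_bij (fun x _ => insert (b, a) (x.2.1 ∪ x.2.2)) ?_ ?_ ?_
  · rintro ⟨A, T₁, T₂⟩ h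
    simp only [Finset.mem_sigma, Finset.mem_filter, Finset.mem_powerset, Finset.mem_product,
      mem_cnatsOn] at h ⊢
    exact IsCnatOn.glue hc h.1.1 h.1.2.1 h.1.2.2 h.2.1 h.2.2
  · rintro ⟨A, T₁, T₂⟩ h ⟨A', T₁', T₂'⟩ h' he
    simp only [Finset.mem_sigma, Finset.mem_filter, Finset.mem_powerset, Finset.mem_product,
      mem_cnatsOn] at h h' he
    obtain ⟨⟨hAW, ha, hb⟩, h₁, h₂⟩ := h
    obtain ⟨⟨hAW', ha', hb'⟩, h₁', h₂'⟩ := h'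
    obtain rfl : A = A' := (IsCnatOn.glue_part_subset hc hAW ha hb ha' h₁ h₁' h₂' he).antisymm
      (IsCnatOn.glue_part_subset hc hAW' ha' hb' ha h₁' h₁ h₂ he.symm)
    have e1 : T₁ = T₁' := by
      rw [← IsCnatOn.glue_filter_left (a := a) hb h₁ h₂, he, IsCnatOn.glue_filter_left hb h₁' h₂']
    have e2 : T₂ = T₂' := by
      rw [← IsCnatOn.glue_filter_right (b := b) ha h₁ h₂, he,
        IsCnatOn.glue_filter_right ha h₁' h₂']
    rw [e1, e2]
  · intro T hT
    rw [mem_cnatsOn] at hT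
    -- For surjectivity, the first part consists of the leaves descending through the first column.
    set A := W.filter fun w => Descends p q a b T w w with hAdef
    have hAW : A ⊆ W := Finset.filter_subset _ _
    have hA : ∀ w ∈ W, w ∈ A ↔ Descends p q a b T w w := fun w hw => by simp [hAdef, hw]
    have ha : a ∈ A := (hA a hc.mem_col).2 (.base a (hT.leaf a hc.mem_col) hab)
    have hb : b ∉ A := fun hb => ((hA b hc.mem_row).1 hb).row_ne hT hc rfl
    refine ⟨⟨A, T.filter fun x => x.1 ∈ A ∧ x.2 ∈ A, T.filter fun x => x.1 ∉ A ∧ x.2 ∉ A⟩, ?_, ?_⟩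
    · simp only [Finset.mem_sigma, Finset.mem_filter, Finset.mem_powerset, Finset.mem_product,
        mem_cnatsOn]
      exact ⟨⟨hAW, ha, hb⟩, hT.isCnatOn_descendants hc hAW hA (by simp),
        hT.isCnatOn_nondescendants hc hab hA (by simp)⟩
    · ext ⟨k, j⟩
      simp only [Finset.mem_insert, Finset.mem_union, Finset.mem_filter, Prod.mk.injEq]
      constructor
      · rintro (⟨rfl, rfl⟩ | h | h)
        · exact hT.root_mem hc
        · exact h.1
        · exact h.1
      · intro hkj
        have hk := hT.row_mem _ _ hkj
        have hj := hT.col_mem _ _ hkj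
        by_cases hkb : k = b
        · subst hkb
          by_cases hja : j = a
          · exact Or.inl ⟨rfl, hja⟩
          · refine Or.inr (Or.inr ⟨hkj, hb, fun h => ?_⟩)
            exact ((hA j hj).1 h).first_row_notMem hT hc hja hkj
        · have : k ∈ A ↔ j ∈ A := by
            rw [hA k hk, hA j hj, Descends.iff_row hT hc hkj, Descends.iff_col hT hc hkj hkb]
          tauto

theorem isSplitCount_card_cnatsOn (hp : p.Injective) (hq : q.Injective) :
    IsSplitCount (invGraph p q) fun W => (cnatsOn p q W).card := by
  refine ⟨card_cnatsOn_singleton, fun W hW he => ?_, fun W => ?_⟩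
  · obtain ⟨a, b, hc⟩ := exists_isFirstCell hp hq hW.nonempty
    by_cases hab : a = b
    · subst hab; exact card_cnatsOn_eq_zero hW hc
    · exact absurd (hc.adj hab) (he a hc.mem_col b hc.mem_row)
  · induction W using Finset.strongInduction with
    | H W ih =>
      intro c d hcW hdW hcd
      obtain ⟨a, b, hc⟩ := exists_isFirstCell hp hq ⟨c, hcW⟩
      by_cases hab : a = b
      · subst hab
        -- Here `a` is isolated. The part containing it also contains `c` or `d`, so it has the same
        -- degenerate corner, and both sides of the recurrence vanish.
        have hiso : ∀ x ∈ W, ¬ (invGraph p q).Adj a x := by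
          intro x hx h
          have h1 := hc.col_le x hx
          have h2 := hc.row_le x hx
          rw [invGraph_adj] at h; omega
        have hca : c ≠ a := fun e => hiso d hdW (e ▸ hcd)
        have hda : d ≠ a := fun e => hiso c hcW (e ▸ hcd.symm)
        simp only [card_cnatsOn_eq_zero ⟨c, hcW, a, hc.mem_col, hca⟩ hc]
        symm
        refine Finset.sum_eq_zero fun A hA => ?_
        rw [Finset.mem_powerset] at hA
        split_ifs with hA'
        · beta_reduce
          by_cases ha : a ∈ A
          · rw [card_cnatsOn_eq_zero ⟨c, hA'.1, a, ha, hca⟩ (hc.mono hA ha ha), zero_mul]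
          · have ha' := Finset.mem_sdiff.2 ⟨hc.mem_col, ha⟩
            rw [card_cnatsOn_eq_zero ⟨d, Finset.mem_sdiff.2 ⟨hdW, hA'.2⟩, a, ha', hda⟩
              (hc.mono Finset.sdiff_subset ha' ha'), mul_zero]
        · rfl
      · refine (card_cnatsOn_eq_splitSum hc hab).trans ?_
        exact splitSum_exchange _ hc.mem_col hc.mem_row hcW hdW
          (fun X hX hcX hdX => ih X hX c d hcX hdX hcd)
          (fun X hX haX hbX => ih X hX a b haX hbX (hc.adj hab))

end CnatCount

/-! ### Back to fillings of the square grid -/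

section Permutations

variable {n : ℕ} (π : Equiv.Perm (Fin n))

/-- Row `k` of `T'` is row `π k` of `T`. Completeness matches the conditions `row_le`, `col_le` and
`leaf`: a dot other than a leaf has the leaf of its column below it and the leaf of its row to its
right. -/
theorem isCnatOn_iff (T : Filling n n) (T' : Finset (Fin n × Fin n))
    (hT : ∀ k j, (k, j) ∈ T' ↔ (π k, j) ∈ T) :
    IsCnatOn (fun j : Fin n => (j : ℕ)) (fun j => (π j : ℕ)) Finset.univ T' ↔
      T ∈ cnatSet π := by
  have habove : ∀ k j, DotAbove (fun j => (π j : ℕ)) T' k j ↔ T.HasAbove (π k) j := by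
    intro k j
    constructor
    · rintro ⟨k', h1, h2⟩; exact ⟨π k', h1, (hT _ _).1 h2⟩
    · rintro ⟨i, h1, h2⟩
      exact ⟨π.symm i, by simpa using h1, (hT _ _).2 (by simpa using h2)⟩
  have hleft : ∀ k j, DotLeft (fun j : Fin n => (j : ℕ)) T' k j ↔ T.HasLeft (π k) j := by
    intro k j
    constructor
    · rintro ⟨j', h1, h2⟩; exact ⟨j', h1, (hT _ _).1 h2⟩
    · rintro ⟨j', h1, h2⟩; exact ⟨j', h1, (hT _ _).2 h2⟩
  constructor
  · intro h
    have hleaf : ∀ j, (π j, j) ∈ T := fun j => (hT j j).1 (h.leaf j (Finset.mem_univ j))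
    have hrow : ∀ i j, (i, j) ∈ T → i ≤ π j ∧ j ≤ π.symm i := by
      intro i j hij
      have : (π.symm i, j) ∈ T' := (hT _ _).2 (by simpa using hij)
      exact ⟨by simpa using h.row_le _ _ this, h.col_le _ _ this⟩
    have hbelow : ∀ i j, (i, j) ∈ T → (T.HasBelow i j ↔ i ≠ π j) := by
      intro i j hij
      constructor
      · rintro ⟨i', h1, h2⟩ rfl
        exact absurd (hrow _ _ h2).1 (not_le.2 h1)
      · exact fun hne => ⟨π j, lt_of_le_of_ne (hrow _ _ hij).1 hne, hleaf j⟩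
    have hright : ∀ i j, (i, j) ∈ T → (T.HasRight i j ↔ i ≠ π j) := by
      intro i j hij
      constructor
      · rintro ⟨j', h1, h2⟩ rfl
        have := (hrow _ _ h2).2
        rw [Equiv.symm_apply_apply] at this
        exact absurd this (not_le.2 h1)
      · intro hne
        refine ⟨π.symm i, lt_of_le_of_ne (hrow _ _ hij).2 fun e => hne ?_, ?_⟩
        · rw [e, Equiv.apply_symm_apply]
        · simpa using hleaf (π.symm i)
    refine ⟨⟨⟨fun i => ⟨π.symm i, by simpa using hleaf (π.symm i)⟩, fun j => ⟨π j, hleaf j⟩, ?_⟩,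
      fun i j hij => (hbelow i j hij).trans (hright i j hij).symm⟩, fun i j => ?_⟩
    · intro i j hij hne
      have hij' : (π.symm i, j) ∈ T' := (hT _ _).2 (by simpa using hij)
      rcases h.parent _ _ hij' with hw | hx
      · have : NeZero n := ⟨by have := i.isLt; omega⟩
        refine absurd ⟨?_, ?_⟩ hne
        · simpa using (hw (π.symm 0) (Finset.mem_univ _)).1
        · simpa using (hw 0 (Finset.mem_univ _)).2
      · rw [habove, hleft] at hx
        simpa using hx
    · constructor
      · rintro ⟨h1, h2, -⟩
        rwa [hbelow i j h1, not_not] at h2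
      · rintro rfl
        have h1 := hleaf j
        exact ⟨h1, by rw [hbelow _ _ h1]; simp, by rw [hright _ _ h1]; simp⟩
  · rintro ⟨hC, hP⟩
    have hleaf : ∀ j, T.IsLeaf (π j) j := fun j => (hP _ _).2 rfl
    refine ⟨by simp, by simp, fun k j hkj => ?_, fun k j hkj => ?_,
      fun j _ => (hT _ _).2 (hleaf j).1, fun k j hkj => ?_⟩
    · by_contra! hlt
      exact (hleaf j).2.1 ⟨π k, hlt, (hT _ _).1 hkj⟩
    · by_contra! hlt
      exact (hleaf k).2.2 ⟨j, hlt, (hT _ _).1 hkj⟩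
    · by_cases h0 : ((π k : Fin n) : ℕ) = 0 ∧ (j : ℕ) = 0
      · exact Or.inl fun w _ => by simp [h0.1, h0.2]
      · right
        rw [habove, hleft]
        exact hC.unique_parent _ _ ((hT _ _).1 hkj) h0

theorem cnat_eq_card_cnatsOn :
    cnat π = (cnatsOn (fun j : Fin n => (j : ℕ)) (fun j => (π j : ℕ)) Finset.univ).card := by
  let e : Fin n × Fin n ≃ Fin n × Fin n := π.prodCongr (Equiv.refl _)
  have he : ∀ (T' : Finset (Fin n × Fin n)) k j, (k, j) ∈ T' ↔ (π k, j) ∈ T'.map e.toEmbedding := by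
    intro T' k j
    rw [Finset.mem_map_equiv]
    simp [e]
  have : cnatSet π = (fun T' : Finset (Fin n × Fin n) => T'.map e.toEmbedding) ''
      (cnatsOn (fun j : Fin n => (j : ℕ)) (fun j => (π j : ℕ)) Finset.univ : Set _) := by
    ext T
    simp only [Set.mem_image, Finset.mem_coe, mem_cnatsOn]
    constructor
    · intro h
      have hT : (T.map e.symm.toEmbedding).map e.toEmbedding = T := by
        rw [Finset.map_map, ← Equiv.trans_toEmbedding]; simp
      refine ⟨T.map e.symm.toEmbedding, ?_, hT⟩
      rw [isCnatOn_iff π _ _ (he _), hT]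
      exact h
    · rintro ⟨T', h, rfl⟩
      rwa [← isCnatOn_iff π _ T' (he T')]
  rw [cnat, this, Set.ncard_image_of_injective _ (Finset.map_injective _), Set.ncard_coe_finset]

theorem cnat_ne_five : cnat π ≠ 5 := by
  rcases Nat.eq_zero_or_pos n with rfl | hn
  -- For `n = 0` there is only one filling.
  · have hsub : (cnatSet π).ncard ≤ 1 := Set.ncard_le_one_of_subsingleton _
    rw [cnat]; omega
  · have : Nonempty (Fin n) := ⟨⟨0, hn⟩⟩
    rw [cnat_eq_card_cnatsOn]
    have hp : Function.Injective fun j : Fin n => (j : ℕ) := Fin.val_injective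
    have hq : Function.Injective fun j : Fin n => (π j : ℕ) := Fin.val_injective.comp π.injective
    exact (isSplitCount_card_cnatsOn hp hq).ne_five hp hq

end Permutations

theorem mainTheorem3 (n : ℕ) :
    numPermsWithCNATs n 5 = 0 ∧ ∀ π : Equiv.Perm (Fin n), cnat π ≠ 5 := by
  refine ⟨?_, cnat_ne_five⟩
  have : permsWithCNATs n 5 = ∅ := Set.eq_empty_of_forall_notMem cnat_ne_five
  rw [numPermsWithCNATs, this, Set.ncard_empty]
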